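/- **Setting.** The arm space is $[0,1]$. The mean-payoff function $f:[0,1]\to[0,1]$ is unknown; playing arm $x$ yields a reward $Y$ which, given the arm, is independent of the past, with a law $\nu_x$ of mean $f(x)$ such that $Y-f(x)$ is $(1/4)$-subgaussian, i.e. $\mathbb E[e^{s(Y-f(x))}]\le e^{s^2/8}$ for all $s\in\mathbb R$. Write $M(f)=\max f$. For $\alpha,L>0$, $\mathcal H(L,\alpha)$ is the set of functions $f:[0,1]\to[0,1]$ for which there is $x^\star\in[0,1]$ with $f(x^\star)=M(f)$ and $|f(x^\star)-f(x)|\le L|x^\star-x|^\alpha$ for all $x\in[0,1]$. **MOSS** with horizon $n$ for $K$ arms chooses at each round an arm $a$ of maximal index; the index is $+\infty$ if $a$ was never chosen, and otherwise $\hat\mu_a+\sqrt{\max(\log(n/(KN_a)),0)/N_a}$, where $N_a$ is the number of times $a$ was chosen and $\hat\mu_a$ the average reward it gave. **CAB1.1** with the uniform discretization in $K$ pieces: at each round MOSS chooses $I\in\{1,\dots,K\}$, an arm $X$ uniform on $[(I-1)/K,I/K]$ is played, and the reward is given to MOSS as the reward of $I$. **GPO** with horizon $T\ge 8$: let $p=\lceil\log_2T\rceil$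 and $n=\lfloor T/(2p)\rfloor$. For $i=1,\dots,p$, run a fresh CAB1.1 (with MOSS of horizon $n$) for $n$ rounds with the uniform discretization in $2^i$ pieces, and let $\tilde X^{(i)}$ be drawn uniformly among the $n$ arms played. Then, for each $i$, play $\tilde X^{(i)}$ another $n$ times and let $\hat\mu^{(i)}$ be the average reward. Return $\tilde X_T=\tilde X^{(\hat\imath)}$ with $\hat\imath\in\arg\max_i\hat\mu^{(i)}$. All ties are broken arbitrarily. The simple regret is $\overline r_T=M(f)-\mathbb E[f(\tilde X_T)]$. **Theorem.** Let $T\ge 8$. GPO with horizon $T$, which does not use $\alpha$ or $L$, satisfies, for all $\alpha>0$ and all $L\ge 2^{\alpha+1/2}\sqrt{\lceil\log_2T\rceil/T}$, $$\sup_{f\in\mathcal H(L,\alpha)}\overline r_T\le\Big(54+\frac{\sqrt\pi}{2}\log_2T\Big)L^{1/(2\alpha+1)}\Big(\frac{\lceil\log_2T\rceil}{T}\Big)^{\alpha/(2\alpha+1)},$$ where the supremum also runs over all reward laws $\nu$ as above. The right-hand side is $\tilde{\mathcal O}\big(L^{1/(2\alpha+1)}T^{-\alpha/(2\alpha+1)}\big)$: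 there are absolute constants $C,k$ such that, for all $T\ge8$ and $\alpha,L>0$, it is at most $C(\log T)^kL^{1/(2\alpha+1)}T^{-\alpha/(2\alpha+1)}$. -/

import Mathlib

open MeasureTheory ProbabilityTheory Set
open scoped NNReal unitInterval

noncomputable section

namespace XBandit

/-! ### Environment -/

/-- The maximum value `M(f)` of a mean-payoff function on the arm space `[0,1]` (the functions
below are bounded and attain their supremum). -/
def maxValue (f : I → ℝ) : ℝ := sSup (range f)

/-- The Hölder-type class `H(L, α)`: functions `f : [0,1] → [0,1]` that attain their maximum at
some `x⋆` with `|f x⋆ - f x| ≤ L |x⋆ - x| ^ α` for every `x`. -/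
def holderClass (L α : ℝ) : Set (I → ℝ) :=
  {f | (∀ x, f x ∈ Icc (0 : ℝ) 1) ∧
    ∃ xs : I, f xs = maxValue f ∧ ∀ x : I, |f xs - f x| ≤ L * |(xs : ℝ) - (x : ℝ)| ^ α}

/-- `ν x` is the law of the reward obtained when arm `x` is played. It is an environment with
mean-payoff function `f` if the reward of `x` has mean `f x` and `Y - f x` is
`1/4`-subgaussian: `E exp(s (Y - f x)) ≤ exp(s² / 8)` for all real `s`. -/
structure IsEnvironment (ν : Kernel I ℝ) (f : I → ℝ) : Prop where
  markov : IsMarkovKernel ν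
  mean : ∀ x, ∫ y, y ∂(ν x) = f x
  subgaussian : ∀ x, HasSubgaussianMGF (fun y => y - f x) (1 / 4 : ℝ≥0) (ν x)

/-! ### Finite-armed bandit algorithms and MOSS -/

/-- A (possibly randomized) algorithm for `K`-armed bandits: given the arms chosen and the rewards
received in the first `t` rounds, the law of the arm chosen in the next round. -/
structure DiscreteAlgorithm (K : ℕ) where
  choose : ∀ t : ℕ, Kernel (Fin t → Fin K × ℝ) (Fin K)
  markov : ∀ t, IsMarkovKernel (choose t)

/-- Number of times that arm `a` was chosen. -/
def pullCount {K t : ℕ} (h : Fin t → Fin K × ℝ) (a : Fin K) : ℕ :=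
  (Finset.univ.filter fun s => (h s).1 = a).card

/-- Average reward of arm `a`. -/
def empMean {K t : ℕ} (h : Fin t → Fin K × ℝ) (a : Fin K) : ℝ :=
  (∑ s, if (h s).1 = a then (h s).2 else 0) / (pullCount h a : ℝ)

/-- The MOSS index of arm `a` for horizon `n`: `+∞` if `a` has not been chosen yet, and otherwise
`μ̂ₐ + √(max(log(n / (K Nₐ)), 0) / Nₐ)`. -/
def mossIndex {K t : ℕ} (n : ℕ) (h : Fin t → Fin K × ℝ) (a : Fin K) : EReal :=
  if pullCount h a = 0 then ⊤
  else ((empMean h a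
    + √(max (Real.log ((n : ℝ) / ((K : ℝ) * (pullCount h a : ℝ)))) 0 / (pullCount h a : ℝ)) : ℝ) :
      EReal)

/-- The algorithm is MOSS with horizon `n`: it always chooses an arm of maximal index, ties being
broken in an arbitrary (possibly randomized) way. -/
def DiscreteAlgorithm.IsMOSS {K : ℕ} (A : DiscreteAlgorithm K) (n : ℕ) : Prop :=
  ∀ (t : ℕ) (h : Fin t → Fin K × ℝ),
    ∀ᵐ a ∂(A.choose t h), ∀ b, mossIndex n h b ≤ mossIndex n h a

/-! ### CAB1.1 -/

/-- The uniform discretization in `K` pieces: for `i < K`, the uniform probability measure on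
`[i / K, (i + 1) / K]`. -/
def disc (K : ℕ) : Kernel (Fin K) I :=
  Kernel.ofFunOfCountable fun i =>
    (volume : Measure I)[|{x : I | (i : ℝ) / K ≤ x ∧ (x : ℝ) ≤ ((i : ℝ) + 1) / K}]

/-- One round of CAB1.1 after a past `h` made of triples (discrete arm `I_s`, arm played `X_s`,
reward `Y_s`): the algorithm `A`, which sees the pairs `(I_s, Y_s)` only, chooses `I`, then
`X ∼ π_I` is played and `Y ∼ ν_X` is received. -/
def cabStep {K : ℕ} (π : Kernel (Fin K) I) (A : DiscreteAlgorithm K) (ν : Kernel I ℝ) (t : ℕ) :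
    Kernel (Fin t → Fin K × I × ℝ) (Fin K × I × ℝ) :=
  ((A.choose t).comap (fun h s => ((h s).1, (h s).2.2)) (by fun_prop)) ⊗ₖ
    (Kernel.prodMkLeft (Fin t → Fin K × I × ℝ) (π ⊗ₖ Kernel.prodMkLeft (Fin K) ν))

/-- Joint law of the triples `(I_s, X_s, Y_s)` in the first `t` rounds of CAB1.1. -/
def cabLaw {K : ℕ} (π : Kernel (Fin K) I) (A : DiscreteAlgorithm K) (ν : Kernel I ℝ) :
    ∀ t : ℕ, Measure (Fin t → Fin K × I × ℝ)
  | 0 => Measure.dirac Fin.elim0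
  | t + 1 => (cabLaw π A ν t ⊗ₘ cabStep π A ν t).map
      fun q => (Fin.snoc q.1 q.2 : Fin (t + 1) → Fin K × I × ℝ)

/-- Law of a recommendation drawn uniformly among the `n` arms played by CAB1.1. -/
def recommendationLaw {K : ℕ} (π : Kernel (Fin K) I) (A : DiscreteAlgorithm K) (ν : Kernel I ℝ)
    (n : ℕ) : Measure I :=
  ((cabLaw π A ν n).prod (uniformOn (univ : Set (Fin n)))).map fun q => (q.1 q.2).2.1

/-! ### GPO -/

/-- `p = ⌈log₂ T⌉`. -/
def numBranches (T : ℕ) : ℕ := ⌈Real.logb 2 T⌉₊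

/-- `⌊T / (2p)⌋`, the length of each exploration run and of each cross-validation run. -/
def phaseLength (T : ℕ) : ℕ := T / (2 * numBranches T)

/-- Sizes of the discretizations: `2, 4, …, 2 ^ p` (branches are numbered from `0`). -/
def gridSize {p : ℕ} (i : Fin p) : ℕ := 2 ^ ((i : ℕ) + 1)

/-- The algorithm GPO with horizon `T` and CAB1.1 (with MOSS) as a sub-algorithm. All that is left
to choose is how ties are broken: in each run of MOSS, and in the final selection of an index of
maximal average reward given the pairs (recommendation, average reward) of the branches. -/
structure GPO (T : ℕ) where
  alg : ∀ i : Fin (numBranches T), DiscreteAlgorithm (gridSize i)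
  isMOSS : ∀ i, (alg i).IsMOSS (phaseLength T)
  select : Kernel (Fin (numBranches T) → I × ℝ) (Fin (numBranches T))
  markov : IsMarkovKernel select
  select_max : ∀ b, ∀ᵐ i ∂(select b), ∀ j, (b j).2 ≤ (b i).2

/-- `n` successive plays of one and the same arm `x`: the law of the rewards. -/
def repeatPlay (ν : Kernel I ℝ) : ∀ n : ℕ, Kernel I (Fin n → ℝ)
  | 0 => Kernel.const I (Measure.dirac Fin.elim0)
  | n + 1 => (repeatPlay ν n ×ₖ ν).map fun q => (Fin.snoc q.1 q.2 : Fin (n + 1) → ℝ)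

/-- The average of the rewards in `n` successive plays of the same arm. -/
def averageReward (ν : Kernel I ℝ) (n : ℕ) : Kernel I ℝ :=
  (repeatPlay ν n).map fun y => (∑ s, y s) / (n : ℝ)

/-- Joint law of the recommendation of branch `i` (exploration) and of its average reward
(cross-validation). -/
def GPO.branchLaw {T : ℕ} (G : GPO T) (ν : Kernel I ℝ) (i : Fin (numBranches T)) :
    Measure (I × ℝ) :=
  recommendationLaw (disc (gridSize i)) (G.alg i) ν (phaseLength T) ⊗ₘ
    averageReward ν (phaseLength T)

/-- Law of the final recommendation of GPO. The branches are run one after the other with fresh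
randomness and exchange no information, so they are independent. -/
def GPO.outputLaw {T : ℕ} (G : GPO T) (ν : Kernel I ℝ) : Measure I :=
  (Measure.pi (G.branchLaw ν) ⊗ₘ G.select).map fun q => (q.1 q.2).1

/-- The simple regret `M(f) - E[f(X̃_T)]`. -/
def GPO.simpleRegret {T : ℕ} (G : GPO T) (ν : Kernel I ℝ) (f : I → ℝ) : ℝ :=
  maxValue f - ∫ x, f x ∂(G.outputLaw ν)

/-! ### The algorithm exists (ties can be broken measurably) -/

theorem exists_argmax_kernel {H : Type*} [MeasurableSpace H] {K : ℕ} (hK : 0 < K) (idx : H → Fin K → EReal)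
    (hm : ∀ a, Measurable fun h => idx h a) :
    ∃ κ : Kernel H (Fin K), IsMarkovKernel κ ∧ ∀ h, ∀ᵐ a ∂(κ h), ∀ b, idx h b ≤ idx h a := by
  classical
  have : Nonempty (Fin K) := ⟨⟨0, hK⟩⟩
  have hex : ∀ h, ∃ a, ∀ b, idx h b ≤ idx h a := fun h => Finite.exists_max (idx h)
  let S : H → Finset (Fin K) := fun h => Finset.univ.filter fun a => ∀ b, idx h b ≤ idx h a
  have hS : ∀ h, (S h).Nonempty := fun h => by
    obtain ⟨a, ha⟩ := hex h; exact ⟨a, by simpa [S] using ha⟩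
  let sel : H → Fin K := fun h => (S h).min' (hS h)
  have hin : ∀ h, ∀ b, idx h b ≤ idx h (sel h) := fun h => by
    have := (S h).min'_mem (hS h); simpa [S] using this
  have hsel : Measurable sel := by
    refine measurable_to_countable' fun a => ?_
    have : sel ⁻¹' {a} = {h | (∀ b, idx h b ≤ idx h a) ∧ ∀ c, c < a → ¬ ∀ b, idx h b ≤ idx h c} := by
      ext h
      simp only [mem_preimage, mem_singleton_iff, mem_ofPred_eq]
      constructor
      · rintro rfl
        refine ⟨hin h, fun c hc hcb => ?_⟩
        have : sel h ≤ c := (S h).min'_le c (by simpa [S] using hcb)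
        exact absurd hc (not_lt.mpr this)
      · rintro ⟨h1, h2⟩
        apply le_antisymm
        · exact (S h).min'_le a (by simpa [S] using h1)
        · by_contra hlt
          exact h2 _ (not_le.mp hlt) (hin h)
    rw [this]
    have hA : ∀ a, MeasurableSet {h | ∀ b, idx h b ≤ idx h a} := fun a => by
      rw [show {h | ∀ b, idx h b ≤ idx h a} = ⋂ b, {h | idx h b ≤ idx h a} by ext; simp]; exact MeasurableSet.iInter fun b => measurableSet_le (hm b) (hm a)
    refine (hA a).inter ?_
    have hset : {h | ∀ c, c < a → ¬ ∀ b, idx h b ≤ idx h c} =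
        ⋂ c, {h | c < a → ¬ ∀ b, idx h b ≤ idx h c} := by ext; simp
    change MeasurableSet {h | ∀ c, c < a → ¬ ∀ b, idx h b ≤ idx h c}
    rw [hset]; refine MeasurableSet.iInter fun c => ?_
    by_cases hc : c < a
    · simp only [hc, true_imp_iff]
      exact (hA c).compl
    · simp [hc]
  refine ⟨Kernel.deterministic sel hsel, inferInstance, fun h => ?_⟩
  rw [Kernel.deterministic_apply]
  rw [ae_dirac_iff]
  · exact hin h
  · exact MeasurableSet.of_discrete

theorem meas_moss {K t : ℕ} (n : ℕ) (a : Fin K) :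
    Measurable fun h : Fin t → Fin K × ℝ => mossIndex n h a := by
  have hset : ∀ s : Fin t, MeasurableSet {h : Fin t → Fin K × ℝ | (h s).1 = a} := fun s =>
    measurableSet_eq_fun (by fun_prop) measurable_const
  have hp : Measurable fun h : Fin t → Fin K × ℝ => pullCount h a := by
    unfold pullCount
    simp only [Finset.card_filter]
    exact Finset.measurable_sum _ fun s _ => Measurable.ite (hset s) measurable_const measurable_const
  have hpr : Measurable fun h : Fin t → Fin K × ℝ => (pullCount h a : ℝ) :=
    (measurable_from_nat (f := fun k : ℕ => (k : ℝ))).comp hp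
  have he : Measurable fun h : Fin t → Fin K × ℝ => empMean h a := by
    unfold empMean
    exact (Finset.measurable_sum _ fun s _ => Measurable.ite (hset s) (by fun_prop) measurable_const).div hpr
  unfold mossIndex
  refine Measurable.ite (hp (measurableSet_singleton 0)) measurable_const ?_
  refine Measurable.coe_real_ereal ?_
  exact he.add (((Real.measurable_log.comp (measurable_const.div (measurable_const.mul hpr))).max measurable_const).div hpr).sqrt

theorem exists_moss {K : ℕ} (hK : 0 < K) (n : ℕ) : ∃ A : DiscreteAlgorithm K, A.IsMOSS n := by
  choose κ h1 h2 using fun t : ℕ => exists_argmax_kernel hK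
    (fun (h : Fin t → Fin K × ℝ) => mossIndex n h) (meas_moss n)
  exact ⟨⟨κ, h1⟩, h2⟩

theorem p_pos {T : ℕ} (hT : 8 ≤ T) : 0 < numBranches T := by
  unfold numBranches
  rw [Nat.ceil_pos]
  exact Real.logb_pos (by norm_num) (by exact_mod_cast (by omega : 1 < T))

theorem gpo_nonempty {T : ℕ} (hT : 8 ≤ T) : Nonempty (GPO T) := by
  choose A hA using fun i : Fin (numBranches T) => exists_moss (K := gridSize i) (by unfold gridSize; positivity) (phaseLength T)
  obtain ⟨κ, h1, h2⟩ := exists_argmax_kernel (p_pos hT)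
    (fun (b : Fin (numBranches T) → I × ℝ) j => (((b j).2 : ℝ) : EReal)) (fun a => by
      exact Measurable.coe_real_ereal (by fun_prop))
  exact ⟨⟨A, hA, κ, h1, fun b => by simpa using h2 b⟩⟩

end XBandit

end

noncomputable section

namespace XBandit

/-! GPO loses little against its best branch, and one of its grids is close to optimal. Write p for
the number of branches, n for the phase length, ρ = p/T.

One branch with K pieces. Let m₀ = M(f) - L K^(-α). On the cell containing x⋆, f is a.s. at least
m₀, so rewards of that cell have a subgaussian lower tail around m₀. It can therefore serve as
comparator even though its rewards are a mixture. Rewards of any other piece are subgaussian around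
the mean of f on the piece, with the reward noise and the spread of f adding up. MOSS then has
pseudo-regret at most 16√(nK) + K with respect to m₀ (`lintegral_sum_gap_le`), and a uniform draw
among the rounds gives simple regret at most L K^(-α) + 17√(K/n)
(`IsEnvironment.maxValue_sub_integral_recommendationLaw_le`).

The MOSS bound combines a pathwise decomposition (`sum_gap_le`) with two deviation estimates derived
from Ville's inequality (`measure_exists_le_prod`): the comparator's indices fall x below m₀ with
probability at most 4K/(n x²), by peeling over dyadic pull counts, and a suboptimal piece is rarely
overestimated.

Cross-validation. Subgaussian averages over n plays make the selection cost at most (log p / 4 +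
1)/√n (`GPO.simpleRegret_le_branch`).

Balance. For κ = (L²/ρ)^(1/(2α+1)), both L κ^(-α) and √(κρ) equal the target rate U. The assumption
on L gives κ ≥ 2. If κ ≤ 2^p, some grid size lies in [κ, 2κ]. Otherwise κ > T, so U ≥ 1 and the
bound is trivial. -/

theorem measurable_finSnoc {α : Type*} [MeasurableSpace α] (n : ℕ) :
    Measurable fun q : (Fin n → α) × α => (Fin.snoc q.1 q.2 : Fin (n + 1) → α) := by
  refine measurable_pi_lambda _ fun i => ?_
  refine Fin.lastCases ?_ (fun j => ?_) i
  · simpa using measurable_snd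
  · simp only [Fin.snoc_castSucc]; fun_prop

theorem measurable_finTake {α : Type*} [MeasurableSpace α] {n m : ℕ} (h : m ≤ n) :
    Measurable fun u : Fin n → α => (Fin.take m h u : Fin m → α) :=
  measurable_pi_lambda _ fun i => measurable_pi_apply (Fin.castLE h i)

/-- What happened before an earlier round is unaffected by appending a round; inductions on the
horizon rest on this. -/
theorem take_snoc {α : Type*} {n m : ℕ} (h : m ≤ n) (h' : m ≤ n + 1) (u : Fin n → α) (q : α) :
    (Fin.take m h' (Fin.snoc u q : Fin (n + 1) → α) : Fin m → α) = Fin.take m h u := by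
  funext i
  have : Fin.castLE h' i = (Fin.castLE h i).castSucc := rfl
  rw [Fin.take_apply, Fin.take_apply, this, Fin.snoc_castSucc]

theorem take_snoc_self {α : Type*} {n : ℕ} (h' : n + 1 ≤ n + 1) (u : Fin n → α) (q : α) :
    (Fin.take (n + 1) h' (Fin.snoc u q : Fin (n + 1) → α) : Fin (n + 1) → α) = Fin.snoc u q :=
  Fin.take_eq_self _

/-- The pairs (arm, reward) seen by the discrete algorithm. -/
def seen {K t : ℕ} (h : Fin t → Fin K × I × ℝ) : Fin t → Fin K × ℝ := fun s => ((h s).1, (h s).2.2)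

theorem measurable_seen {K t : ℕ} :
    Measurable (seen : (Fin t → Fin K × I × ℝ) → Fin t → Fin K × ℝ) := by
  unfold seen; fun_prop

/-- The law of the arm played and of the reward when CAB1.1 chooses the piece `i`. -/
def pieceLaw {K : ℕ} (π : Kernel (Fin K) I) (ν : Kernel I ℝ) : Kernel (Fin K) (I × ℝ) :=
  π ⊗ₖ Kernel.prodMkLeft (Fin K) ν

/-! ### The law of a run of CAB1.1: maximal indices, Ville's inequality, conditional means. -/

section Law

variable {K : ℕ} (π : Kernel (Fin K) I) (A : DiscreteAlgorithm K) (ν : Kernel I ℝ)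

theorem lintegral_cabStep {t : ℕ} (h : Fin t → Fin K × I × ℝ) {F : Fin K × I × ℝ → ENNReal}
    (hF : Measurable F) :
    ∫⁻ q, F q ∂(cabStep π A ν t h) =
      ∫⁻ i, ∫⁻ q, F (i, q) ∂(pieceLaw π ν i) ∂(A.choose t (seen h)) := by
  have := A.markov t
  unfold cabStep
  rw [Kernel.lintegral_compProd _ _ _ hF]
  rfl

theorem ae_cabStep {t : ℕ} (h : Fin t → Fin K × I × ℝ) {p : Fin K → Prop}
    (hp : ∀ᵐ a ∂(A.choose t (seen h)), p a) : ∀ᵐ q ∂(cabStep π A ν t h), p q.1 := by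
  have := A.markov t
  have hm : MeasurableSet {q : Fin K × I × ℝ | p q.1} :=
    measurable_fst (MeasurableSet.of_discrete (s := {a | p a}))
  unfold cabStep
  rw [Kernel.ae_compProd_iff hm]
  rw [Kernel.comap_apply]
  filter_upwards [hp] with a ha
  exact Filter.Eventually.of_forall fun _ => ha

variable [IsMarkovKernel π] [IsMarkovKernel ν]

instance : IsMarkovKernel (pieceLaw π ν) := by unfold pieceLaw; infer_instance

instance (t : ℕ) : IsMarkovKernel (cabStep π A ν t) := by
  have := A.markov t
  unfold cabStep
  infer_instance

instance (t : ℕ) : IsProbabilityMeasure (cabLaw π A ν t) := by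
  induction t with
  | zero => unfold cabLaw; infer_instance
  | succ t ih =>
    unfold cabLaw
    exact Measure.isProbabilityMeasure_map (measurable_finSnoc t).aemeasurable

theorem lintegral_cabLaw_succ {t : ℕ} {F : (Fin (t + 1) → Fin K × I × ℝ) → ENNReal}
    (hF : Measurable F) :
    ∫⁻ h, F h ∂(cabLaw π A ν (t + 1)) =
      ∫⁻ h, ∫⁻ q, F (Fin.snoc h q) ∂(cabStep π A ν t h) ∂(cabLaw π A ν t) := by
  have hs := measurable_finSnoc (α := Fin K × I × ℝ) t
  rw [cabLaw, lintegral_map hF hs]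
  exact Measure.lintegral_compProd (hF.comp hs)

theorem ae_cabLaw_succ {t : ℕ} {p : (Fin (t + 1) → Fin K × I × ℝ) → Prop}
    (hp : MeasurableSet {h | p h})
    (h1 : ∀ᵐ h ∂(cabLaw π A ν t), ∀ᵐ q ∂(cabStep π A ν t h), p (Fin.snoc h q)) :
    ∀ᵐ h ∂(cabLaw π A ν (t + 1)), p h := by
  have hs := measurable_finSnoc (α := Fin K × I × ℝ) t
  rw [cabLaw, ae_map_iff hs.aemeasurable hp]
  exact (Measure.ae_compProd_iff (hs hp)).2 h1

/-- Almost surely, all choices made in a run of CAB1.1 with MOSS have maximal index. -/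
theorem ae_maximal_index {n : ℕ} (hA : A.IsMOSS n) (m : ℕ) :
    ∀ᵐ h ∂(cabLaw π A ν m), ∀ t : Fin m, ∀ b,
      mossIndex n (Fin.take t t.is_lt.le (seen h) : Fin t → Fin K × ℝ) b ≤
        mossIndex n (Fin.take t t.is_lt.le (seen h) : Fin t → Fin K × ℝ) (h t).1 := by
  induction m with
  | zero => exact Filter.Eventually.of_forall fun h t => t.elim0
  | succ m ih =>
    refine ae_cabLaw_succ π A ν ?_ ?_
    · have : ∀ (t : Fin (m + 1)) (b : Fin K), MeasurableSet {h : Fin (m + 1) → Fin K × I × ℝ |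
          mossIndex n (Fin.take t t.is_lt.le (seen h) : Fin t → Fin K × ℝ) b ≤
          mossIndex n (Fin.take t t.is_lt.le (seen h) : Fin t → Fin K × ℝ) (h t).1} := by
        intro t b
        have hx : ∀ a, Measurable fun h : Fin (m + 1) → Fin K × I × ℝ =>
            mossIndex n (Fin.take t t.is_lt.le (seen h) : Fin t → Fin K × ℝ) a := fun a =>
          (meas_moss n a).comp ((measurable_finTake _).comp measurable_seen)
        refine measurableSet_le (hx b) ?_
        have h2 : Measurable fun q : (Fin (m + 1) → Fin K × I × ℝ) × Fin K =>
            mossIndex n (Fin.take t t.is_lt.le (seen q.1) : Fin t → Fin K × ℝ) q.2 :=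
          measurable_from_prod_countable_left hx
        exact h2.comp (g := fun q : (Fin (m + 1) → Fin K × I × ℝ) × Fin K =>
            mossIndex n (Fin.take t t.is_lt.le (seen q.1) : Fin t → Fin K × ℝ) q.2)
          (measurable_id.prodMk (measurable_fst.comp (measurable_pi_apply t)))
      simp only [ofPred_forall]
      exact MeasurableSet.iInter fun t => MeasurableSet.iInter fun b => this t b
    · filter_upwards [ih] with h hh
      have := ae_cabStep π A ν h (hA m (seen h))
      filter_upwards [this] with q hq t
      have hseen : seen (Fin.snoc h q : Fin (m + 1) → Fin K × I × ℝ)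
          = (Fin.snoc (seen h) (q.1, q.2.2) : Fin (m + 1) → Fin K × ℝ) := by
        funext s
        refine Fin.lastCases ?_ (fun j => ?_) s <;> simp [seen]
      rw [hseen]
      refine Fin.lastCases ?_ (fun j => ?_) t
      · intro b
        have := take_snoc le_rfl (Fin.last m).is_lt.le (seen h) (q.1, q.2.2)
        simp only [Fin.snoc_last]
        simp only [Fin.val_last] at this ⊢
        rw [this, Fin.take_eq_self]
        exact hq b
      · intro b
        have := take_snoc j.is_lt.le (j.castSucc).is_lt.le (seen h) (q.1, q.2.2)
        simp only [Fin.snoc_castSucc]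
        simp only [Fin.val_castSucc] at this ⊢
        rw [this]
        exact hh j b

/-- Ville's inequality: if each factor has conditional mean at most one, the running product
exceeds a level `c` with probability at most `1 / c`. -/
theorem measure_exists_le_prod {G : Fin K × I × ℝ → ENNReal} (hG : Measurable G)
    (hG1 : ∀ i, ∫⁻ q, G (i, q) ∂(pieceLaw π ν i) ≤ 1) (c : ENNReal) (n : ℕ) :
    cabLaw π A ν n {h | ∃ t : Fin (n + 1),
      c ≤ ∏ s, G ((Fin.take t t.is_le h : Fin t → Fin K × I × ℝ) s)} ≤ c⁻¹ := by
  classical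
  let E : ∀ n : ℕ, Set (Fin n → Fin K × I × ℝ) := fun n => {h | ∃ t : Fin (n + 1),
      c ≤ ∏ s, G ((Fin.take t t.is_le h : Fin t → Fin K × I × ℝ) s)}
  have hP : ∀ n, Measurable fun h : Fin n → Fin K × I × ℝ => ∏ s, G (h s) := fun n =>
    Finset.measurable_prod _ fun s _ => hG.comp (measurable_pi_apply s)
  have hE : ∀ n, MeasurableSet (E n) := by
    intro n
    simp only [E, ofPred_exists]
    exact MeasurableSet.iUnion fun t =>
      measurableSet_le measurable_const ((hP t).comp (measurable_finTake t.is_le))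
  -- The stopped supermartingale: the running product, frozen at `c` once the level has been
  -- reached. Cutting the overshoot down to `c` can only decrease it, so its mean stays at most 1.
  let Φ : ∀ n : ℕ, (Fin n → Fin K × I × ℝ) → ENNReal := fun n h =>
    if h ∈ E n then c else ∏ s, G (h s)
  have hΦ : ∀ n, Measurable (Φ n) := fun n => Measurable.ite (hE n) measurable_const (hP n)
  have hstep : ∀ n h q, Φ (n + 1) (Fin.snoc h q) ≤
      if h ∈ E n then c else (∏ s, G (h s)) * G q := by
    intro n h q
    by_cases hh : h ∈ E n
    · have : (Fin.snoc h q : Fin (n + 1) → Fin K × I × ℝ) ∈ E (n + 1) := by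
        obtain ⟨t, ht⟩ := hh
        refine ⟨t.castSucc, ?_⟩
        have h1 := take_snoc t.is_le t.castSucc.is_le h q
        simp only [Fin.val_castSucc] at h1 ⊢
        rw [h1]; exact ht
      simp [Φ, hh, this]
    · rw [if_neg hh]
      by_cases hq : (Fin.snoc h q : Fin (n + 1) → Fin K × I × ℝ) ∈ E (n + 1)
      · simp only [Φ, if_pos hq]
        obtain ⟨t, ht⟩ := hq
        induction t using Fin.lastCases with
        | last =>
          have h1 := take_snoc_self (Fin.last (n + 1)).is_le h q
          simp only [Fin.val_last] at h1 ht
          rw [h1, Fin.prod_univ_castSucc] at ht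
          simpa using ht
        | cast t =>
          have h1 := take_snoc t.is_le t.castSucc.is_le h q
          simp only [Fin.val_castSucc] at h1 ht
          rw [h1] at ht
          exact absurd ⟨t, ht⟩ hh
      · simp only [Φ, if_neg hq, Fin.prod_univ_castSucc, Fin.snoc_castSucc, Fin.snoc_last, le_refl]
  have key : ∀ n, ∫⁻ h, Φ n h ∂(cabLaw π A ν n) ≤ 1 := by
    intro n
    induction n with
    | zero =>
      have h1 : ∀ h : Fin 0 → Fin K × I × ℝ, Φ 0 h ≤ 1 := by
        intro h
        by_cases hh : h ∈ E 0
        · simp only [Φ, if_pos hh]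
          obtain ⟨t, ht⟩ := hh
          obtain rfl : t = 0 := Subsingleton.elim (α := Fin 1) t 0
          simpa using ht
        · simp [Φ, if_neg hh]
      exact (lintegral_mono h1).trans (by simp)
    | succ n ih =>
      have := A.markov n
      rw [lintegral_cabLaw_succ π A ν (hΦ _)]
      refine le_trans (lintegral_mono fun h => ?_) ih
      refine (lintegral_mono (hstep n h)).trans ?_
      by_cases hh : h ∈ E n
      · simp [Φ, hh]
      · simp only [Φ, if_neg hh]
        rw [lintegral_const_mul _ hG, lintegral_cabStep π A ν h hG]
        calc (∏ s, G (h s)) * _ ≤ (∏ s, G (h s)) * 1 := by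
              gcongr
              exact (lintegral_mono hG1).trans (by simp)
          _ = _ := mul_one _
  have h1 : c * cabLaw π A ν n (E n) ≤ 1 := by
    refine le_trans ?_ (key n)
    rw [← lintegral_indicator_const (hE n)]
    refine lintegral_mono fun h => ?_
    by_cases hh : h ∈ E n <;> simp [Φ, hh]
  rw [ENNReal.le_inv_iff_mul_le, mul_comm]
  exact h1

/-- The expected sum over the rounds of a function of (piece, arm, reward) only depends on its
conditional means given the piece. -/
theorem lintegral_sum_congr {φ ψ : Fin K × I × ℝ → ENNReal} (hφ : Measurable φ)
    (hψ : Measurable ψ)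
    (h : ∀ i, ∫⁻ q, φ (i, q) ∂(pieceLaw π ν i) = ∫⁻ q, ψ (i, q) ∂(pieceLaw π ν i)) (n : ℕ) :
    ∫⁻ u, ∑ s, φ (u s) ∂(cabLaw π A ν n) = ∫⁻ u, ∑ s, ψ (u s) ∂(cabLaw π A ν n) := by
  have hm : ∀ {φ : Fin K × I × ℝ → ENNReal}, Measurable φ → ∀ n,
      Measurable fun u : Fin n → Fin K × I × ℝ => ∑ s, φ (u s) := fun hφ n =>
    Finset.measurable_sum _ fun s _ => hφ.comp (measurable_pi_apply s)
  have hstep : ∀ {φ : Fin K × I × ℝ → ENNReal}, Measurable φ → ∀ n,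
      ∫⁻ u, ∑ s, φ (u s) ∂(cabLaw π A ν (n + 1)) = ∫⁻ u, ∑ s, φ (u s) ∂(cabLaw π A ν n) +
        ∫⁻ u, ∫⁻ i, ∫⁻ q, φ (i, q) ∂(pieceLaw π ν i) ∂(A.choose n (seen u))
          ∂(cabLaw π A ν n) := by
    intro φ hφ n
    rw [lintegral_cabLaw_succ π A ν (hm hφ _), ← lintegral_add_left (hm hφ n)]
    refine lintegral_congr fun u => ?_
    simp only [Fin.sum_univ_castSucc, Fin.snoc_castSucc, Fin.snoc_last]
    rw [lintegral_add_left measurable_const, lintegral_cabStep π A ν u hφ]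
    simp
  induction n with
  | zero => simp
  | succ n ih => rw [hstep hφ, hstep hψ, ih]; simp only [h]

end Law

/-! ### Elementary sums -/

/-- Telescoping: with v = 2^j y / 2, the inequality v + 1 ≤ e^v gives v e^(-2v) ≤ e^(-v) - e^(-2v),
and the next v is 2v. -/
theorem sum_two_pow_mul_exp_le {y : ℝ} (hy : 0 < y) (n : ℕ) :
    ∑ j ∈ Finset.range n, (2 : ℝ) ^ j * Real.exp (-(2 ^ j * y)) ≤ 2 / y := by
  have h : ∀ n, ∑ j ∈ Finset.range n, (2 : ℝ) ^ j * Real.exp (-(2 ^ j * y)) ≤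
      2 / y * (1 - Real.exp (-(2 ^ n * y / 2))) := by
    intro n
    induction n with
    | zero =>
      have : Real.exp (-(2 ^ 0 * y / 2)) ≤ 1 := Real.exp_le_one_iff.2 (by simp; positivity)
      simp only [Finset.range_zero, Finset.sum_empty]
      exact mul_nonneg (by positivity) (by linarith)
    | succ n ih =>
      rw [Finset.sum_range_succ]
      set v := 2 ^ n * y / 2 with hv
      have hvpos : 0 < v := by positivity
      have e1 : (2 : ℝ) ^ n * y = v + v := by rw [hv]; ring
      have e2 : (2 : ℝ) ^ (n + 1) * y / 2 = v + v := by rw [hv]; ring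
      have e3 : (2 : ℝ) ^ n = 2 / y * v := by rw [hv]; field_simp
      rw [e1, e2, e3]
      have hexp : Real.exp (-(v + v)) * Real.exp v = Real.exp (-v) := by
        rw [← Real.exp_add]; congr 1; ring
      have h1 : v + 1 ≤ Real.exp v := Real.add_one_le_exp v
      have h2 : v * Real.exp (-(v + v)) ≤ Real.exp (-v) - Real.exp (-(v + v)) := by
        nlinarith [Real.exp_pos (-(v + v))]
      have h3 := mul_le_mul_of_nonneg_left h2 (by positivity : 0 ≤ 2 / y)
      nlinarith
  refine (h n).trans ?_
  have : 0 ≤ 2 / y * Real.exp (-(2 ^ n * y / 2)) := by positivity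
  linarith

theorem sum_exp_neg_mul_le {y : ℝ} (hy : 0 < y) (n : ℕ) :
    ∑ s ∈ Finset.range n, Real.exp (-(((s : ℝ) + 1) * y)) ≤ 1 / y := by
  have h : ∀ n : ℕ, ∑ s ∈ Finset.range n, Real.exp (-(((s : ℝ) + 1) * y)) ≤
      1 / y * (1 - Real.exp (-(n * y))) := by
    intro n
    induction n with
    | zero => simp
    | succ n ih =>
      rw [Finset.sum_range_succ]
      push_cast
      have hexp : Real.exp (-(((n : ℝ) + 1) * y)) * Real.exp y = Real.exp (-(n * y)) := by
        rw [← Real.exp_add]; congr 1; ring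
      have h1 : y + 1 ≤ Real.exp y := Real.add_one_le_exp y
      have h2 : y * Real.exp (-(((n : ℝ) + 1) * y)) ≤
          Real.exp (-(n * y)) - Real.exp (-(((n : ℝ) + 1) * y)) := by
        nlinarith [Real.exp_pos (-(((n : ℝ) + 1) * y))]
      have h3 := mul_le_mul_of_nonneg_left h2 (by positivity : 0 ≤ 1 / y)
      rw [← mul_assoc, one_div_mul_cancel hy.ne', one_mul] at h3
      nlinarith
  refine (h n).trans ?_
  have : 0 ≤ 1 / y * Real.exp (-(n * y)) := by positivity
  linarith

/-- Integrates the 1/x² tail of the comparator's underestimation; only the part beyond a threshold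
`δ` has a finite integral. -/
theorem lintegral_Ioi_inv_sq {δ c : ℝ} (hδ : 0 < δ) (hc : 0 ≤ c) :
    ∫⁻ x in Ioi (0 : ℝ), ENNReal.ofReal (c / (x + δ) ^ 2) = ENNReal.ofReal (c / δ) := by
  have hd : ∀ x ∈ Ici (0 : ℝ), HasDerivAt (fun x : ℝ => -c * (x + δ)⁻¹) (c / (x + δ) ^ 2) x := by
    intro x hx
    have hx' : x + δ ≠ 0 := by have : (0 : ℝ) ≤ x := hx; positivity
    have := (((hasDerivAt_id x).add_const δ).inv hx').const_mul (-c)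
    exact this.congr_deriv (by simp [div_eq_mul_inv])
  have hn : ∀ x ∈ Ioi (0 : ℝ), 0 ≤ c / (x + δ) ^ 2 := fun x _ => by positivity
  have ht : Filter.Tendsto (fun x : ℝ => -c * (x + δ)⁻¹) Filter.atTop (nhds 0) := by
    have := (tendsto_inv_atTop_zero.comp
      (Filter.tendsto_atTop_add_const_right Filter.atTop δ Filter.tendsto_id)).const_mul (-c)
    simpa [Function.comp_def] using this
  rw [← ofReal_integral_eq_lintegral_ofReal (integrableOn_Ioi_deriv_of_nonneg' hd hn ht)
    ((ae_restrict_iff' measurableSet_Ioi).2 (Filter.Eventually.of_forall hn)),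
    integral_Ioi_of_hasDerivAt_of_nonneg' hd hn ht]
  congr 1
  simp [div_eq_mul_inv]

/-! ### Pull counts and empirical means -/

/-- The exploration bonus of MOSS after `N` pulls, with `m = n / K`. -/
def bonus (m N : ℝ) : ℝ := √(max (Real.log (m / N)) 0 / N)

/-- Since log z ≤ z. The decay in 1/N brings the bonus below D/4 after 4√m/D pulls. -/
theorem bonus_le {m N : ℝ} (hm : 0 < m) (hN : 0 < N) : bonus m N ≤ √m / N := by
  unfold bonus
  rw [Real.sqrt_le_left (by positivity), div_pow, Real.sq_sqrt hm.le, pow_two, ← div_div]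
  gcongr
  have : Real.log (m / N) ≤ m / N := (Real.log_le_sub_one_of_pos (by positivity)).trans (by linarith)
  exact max_le this (by positivity)

theorem mossIndex_of_pullCount_ne_zero {K t : ℕ} (n : ℕ) (u : Fin t → Fin K × ℝ) (a : Fin K)
    (h : pullCount u a ≠ 0) :
    mossIndex n u a = ((empMean u a + bonus ((n : ℝ) / K) (pullCount u a) : ℝ) : EReal) := by
  rw [mossIndex, if_neg h, bonus, div_div]

theorem pullCount_le {K t : ℕ} (u : Fin t → Fin K × ℝ) (a : Fin K) : pullCount u a ≤ t := by
  unfold pullCount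
  exact (Finset.card_le_univ _).trans (by simp)

theorem pullCount_mul_empMean {K t : ℕ} (u : Fin t → Fin K × ℝ) (a : Fin K) :
    (pullCount u a : ℝ) * empMean u a = ∑ s, if (u s).1 = a then (u s).2 else 0 := by
  unfold empMean
  by_cases h : pullCount u a = 0
  · rw [h]
    have h' := h
    unfold pullCount at h'
    rw [Finset.card_eq_zero, Finset.filter_eq_empty_iff] at h'
    rw [Finset.sum_eq_zero fun s _ => if_neg (h' (Finset.mem_univ s))]
    simp
  · field_simp

/-- Identifies the exponential supermartingale of one piece: rounds devoted to other pieces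
contribute a factor 1, so only the pull count and the empirical mean of `a` remain. -/
theorem prod_tilt {K t : ℕ} (u : Fin t → Fin K × ℝ) (a : Fin K) (l μ v : ℝ) :
    (∏ s, if (u s).1 = a then ENNReal.ofReal (Real.exp (l * ((u s).2 - μ) - v)) else 1) =
      ENNReal.ofReal (Real.exp (pullCount u a * (l * (empMean u a - μ) - v))) := by
  have h1 : ∀ s, (if (u s).1 = a then ENNReal.ofReal (Real.exp (l * ((u s).2 - μ) - v)) else 1) =
      ENNReal.ofReal (Real.exp (if (u s).1 = a then l * ((u s).2 - μ) - v else 0)) := by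
    intro s; split_ifs <;> simp
  simp_rw [h1]
  rw [← ENNReal.ofReal_prod_of_nonneg (fun _ _ => (Real.exp_pos _).le), ← Real.exp_sum]
  congr 2
  have h2 : ∀ s, (if (u s).1 = a then l * ((u s).2 - μ) - v else 0) =
      l * (if (u s).1 = a then (u s).2 else 0) - (l * μ + v) * (if (u s).1 = a then 1 else 0) := by
    intro s; split_ifs <;> ring
  simp_rw [h2]
  rw [Finset.sum_sub_distrib, ← Finset.mul_sum, ← Finset.mul_sum, ← pullCount_mul_empMean,
    Finset.sum_boole]
  unfold pullCount
  ring

theorem pullCount_take {K n t : ℕ} (ht : t ≤ n) (u : Fin n → Fin K × ℝ) (a : Fin K) :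
    pullCount (Fin.take t ht u : Fin t → Fin K × ℝ) a =
      (Finset.univ.filter fun s : Fin n => (s : ℕ) < t ∧ (u s).1 = a).card := by
  unfold pullCount
  rw [← Finset.card_map (Fin.castLEEmb ht)]
  congr 1
  ext s
  rw [Finset.mem_map, Finset.mem_filter, and_iff_right (Finset.mem_univ s)]
  constructor
  · rintro ⟨r, hr, rfl⟩
    exact ⟨r.is_lt, (Finset.mem_filter.1 hr).2⟩
  · rintro ⟨h1, h2⟩
    exact ⟨⟨s, h1⟩, Finset.mem_filter.2 ⟨Finset.mem_univ _, h2⟩, rfl⟩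

/-- The number of earlier pulls strictly increases along the rounds in which `a` is chosen. -/
theorem pullCount_take_lt {K n : ℕ} (u : Fin n → Fin K × ℝ) (a : Fin K) {t r : Fin n}
    (htr : t < r) (ht : (u t).1 = a) :
    pullCount (Fin.take t t.is_lt.le u : Fin t → Fin K × ℝ) a <
      pullCount (Fin.take r r.is_lt.le u : Fin r → Fin K × ℝ) a := by
  rw [pullCount_take, pullCount_take]
  refine Finset.card_lt_card (Finset.ssubset_iff_subset_ne.2 ⟨?_, ?_⟩)
  · intro s hs
    simp only [Finset.mem_filter, Finset.mem_univ, true_and] at hs ⊢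
    exact ⟨hs.1.trans htr, hs.2⟩
  · intro he
    have : t ∈ Finset.univ.filter fun s : Fin n => (s : ℕ) < r ∧ (u s).1 = a := by
      simp only [Finset.mem_filter, Finset.mem_univ, true_and]
      exact ⟨htr, ht⟩
    rw [← he] at this
    simp at this

/-- If all late pulls of `a` require an exceptional event, `a` is chosen rarely. -/
theorem pullCount_le_of_forall {K n : ℕ} (u : Fin n → Fin K × ℝ) (a : Fin K) {s₀ : ℝ}
    (hs₀ : 0 ≤ s₀) (E : ℕ → Prop) [DecidablePred E]
    (hE : ∀ t : Fin n, (u t).1 = a →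
      s₀ ≤ pullCount (Fin.take t t.is_lt.le u : Fin t → Fin K × ℝ) a →
      ∃ s, pullCount (Fin.take t t.is_lt.le u : Fin t → Fin K × ℝ) a = s + 1 ∧ E s) :
    (pullCount u a : ℝ) ≤ s₀ + 1 + ∑ s ∈ Finset.range n, if E s then 1 else 0 := by
  set N : Fin n → ℕ := fun t => pullCount (Fin.take t t.is_lt.le u : Fin t → Fin K × ℝ) a with hN
  set S := Finset.univ.filter fun s : Fin n => (u s).1 = a with hS
  have hinj : Set.InjOn N S := by
    intro t ht r hr htr
    simp only [hS, Finset.coe_filter, Finset.mem_univ, true_and] at ht hr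
    rcases lt_trichotomy t r with h | h | h
    · exact absurd htr (pullCount_take_lt u a h ht).ne
    · exact h
    · exact absurd htr.symm (pullCount_take_lt u a h hr).ne
  -- Distinct pulls of `a` have distinct earlier counts, so pulls can be counted through these
  -- values: either below `s₀`, or of the form s + 1 with `E s`.
  have hsub : S.image N ⊆ Finset.range ⌈s₀⌉₊ ∪
      ((Finset.range n).filter E).image (· + 1) := by
    intro k hk
    obtain ⟨t, ht, rfl⟩ := Finset.mem_image.1 hk
    simp only [hS, Finset.mem_filter, Finset.mem_univ, true_and] at ht
    rcases lt_or_ge (N t : ℝ) s₀ with h | h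
    · exact Finset.mem_union_left _ (Finset.mem_range.2 (Nat.lt_ceil.2 h))
    · obtain ⟨s, hs, hEs⟩ := hE t ht h
      refine Finset.mem_union_right _ (Finset.mem_image.2 ⟨s, ?_, hs.symm⟩)
      have h1 := pullCount_le (Fin.take t t.is_lt.le u : Fin t → Fin K × ℝ) a
      have h2 := t.is_lt
      exact Finset.mem_filter.2 ⟨Finset.mem_range.2 (by omega), hEs⟩
  have hcard : pullCount u a ≤ ⌈s₀⌉₊ + ((Finset.range n).filter E).card := by
    have h1 : pullCount u a = (S.image N).card := by
      rw [Finset.card_image_of_injOn hinj]; rfl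
    rw [h1]
    refine (Finset.card_le_card hsub).trans ((Finset.card_union_le (Finset.range ⌈s₀⌉₊) _).trans ?_)
    rw [Finset.card_range]
    exact Nat.add_le_add_left Finset.card_image_le _
  have h2 : (pullCount u a : ℝ) ≤ ⌈s₀⌉₊ + ((Finset.range n).filter E).card := by
    exact_mod_cast hcard
  rw [Finset.sum_boole]
  have := (Nat.ceil_lt_add_one hs₀).le
  linarith

/-! ### Pathwise decomposition of the regret of MOSS. -/

open Classical in
/-- Pathwise bound on the pseudo-regret of MOSS with respect to the level `m₀`: `Z` bounds how much
the indices of the comparator `a₀` underestimate `m₀`. -/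
theorem sum_gap_le {K n : ℕ} (hK : 0 < K) (hn : 0 < n) (u : Fin n → Fin K × ℝ)
    (hu : ∀ t : Fin n, ∀ b,
      mossIndex n (Fin.take t t.is_lt.le u : Fin t → Fin K × ℝ) b ≤
        mossIndex n (Fin.take t t.is_lt.le u : Fin t → Fin K × ℝ) (u t).1)
    (a₀ : Fin K) (m₀ Z : ℝ) (μ : Fin K → ℝ) {Δ₀ : ℝ} (hΔ₀ : 0 < Δ₀)
    (hZ : ∀ t : Fin n, pullCount (Fin.take t t.is_lt.le u : Fin t → Fin K × ℝ) a₀ ≠ 0 →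
      m₀ - (empMean (Fin.take t t.is_lt.le u : Fin t → Fin K × ℝ) a₀ + bonus ((n : ℝ) / K)
        (pullCount (Fin.take t t.is_lt.le u : Fin t → Fin K × ℝ) a₀)) ≤ Z) :
    ∑ t, (m₀ - μ (u t).1) ≤ n * (Δ₀ + 2 * max (Z - Δ₀ / 2) 0) +
      ∑ a, if Δ₀ < m₀ - μ a then (m₀ - μ a) * (4 * √((n : ℝ) / K) / (m₀ - μ a) + 1 +
        ∑ s ∈ Finset.range n, if ∃ t : Fin n,
          pullCount (Fin.take t t.is_lt.le u : Fin t → Fin K × ℝ) a = s + 1 ∧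
          (m₀ - μ a) / 4 ≤ empMean (Fin.take t t.is_lt.le u : Fin t → Fin K × ℝ) a - μ a
          then 1 else 0) else 0 := by
  set m : ℝ := (n : ℝ) / K with hm
  have hmpos : 0 < m := by positivity
  -- The bracket equals max(Δ₀, 2Z): it pays for every round whose gap is at most that, and only
  -- larger gaps are charged to individual pieces.
  have h1 : ∀ t, m₀ - μ (u t).1 ≤ (Δ₀ + 2 * max (Z - Δ₀ / 2) 0) +
      ∑ a, if (u t).1 = a then
        (if Δ₀ < m₀ - μ a ∧ 2 * Z < m₀ - μ a then m₀ - μ a else 0) else 0 := by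
    intro t
    rw [Finset.sum_ite_eq]
    simp only [Finset.mem_univ, if_true]
    have h2 := le_max_left (Z - Δ₀ / 2) 0
    have h3 := le_max_right (Z - Δ₀ / 2) 0
    split_ifs with h
    · linarith
    · rw [not_and_or, not_lt, not_lt] at h
      rcases h with h | h <;> linarith
  refine (Finset.sum_le_sum fun t _ => h1 t).trans ?_
  rw [Finset.sum_add_distrib, Finset.sum_const, Finset.card_univ, Fintype.card_fin, nsmul_eq_mul,
    Finset.sum_comm]
  gcongr with a _
  by_cases hΔ : Δ₀ < m₀ - μ a
  swap
  · simp [hΔ]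
  simp only [hΔ, true_and, if_true]
  set D := m₀ - μ a with hD
  have hDpos : 0 < D := hΔ₀.trans hΔ
  by_cases hZD : 2 * Z < D
  swap
  · simp only [hZD, if_false, ite_self, Finset.sum_const_zero]
    have : 0 ≤ ∑ s ∈ Finset.range n, (if ∃ t : Fin n,
          pullCount (Fin.take t t.is_lt.le u : Fin t → Fin K × ℝ) a = s + 1 ∧
          D / 4 ≤ empMean (Fin.take t t.is_lt.le u : Fin t → Fin K × ℝ) a - μ a
          then (1 : ℝ) else 0) :=
      Finset.sum_nonneg fun s _ => by split_ifs <;> norm_num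
    positivity
  simp only [hZD, if_true]
  have hsum : ∑ t, (if (u t).1 = a then D else 0) = D * pullCount u a := by
    rw [← Finset.sum_filter, Finset.sum_const, nsmul_eq_mul, mul_comm]; rfl
  rw [hsum]
  refine mul_le_mul_of_nonneg_left ?_ hDpos.le
  -- Choosing `a` forces its index to be at least m₀ - Z > μ a + D/2. After `s₀` pulls the bonus
  -- accounts for at most D/4, so the empirical mean exceeds `μ a` by at least D/4.
  refine pullCount_le_of_forall u a (s₀ := 4 * √m / D) (by positivity) _ fun t ht hN => ?_
  have hs0 : 0 < 4 * √m / D := by positivity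
  set w : Fin t → Fin K × ℝ := Fin.take t t.is_lt.le u with hw
  have hNpos : (0 : ℝ) < pullCount w a := hs0.trans_le hN
  have hN0 : pullCount w a ≠ 0 := by
    intro h; rw [h] at hNpos; simp at hNpos
  obtain ⟨s, hs⟩ := Nat.exists_eq_succ_of_ne_zero hN0
  refine ⟨s, hs, t, hs, ?_⟩
  have hidx := hu t a₀
  rw [ht, mossIndex_of_pullCount_ne_zero n _ a hN0] at hidx
  -- A comparator not yet pulled would have index +∞ and beat the finite index of `a`.
  have hN0' : pullCount w a₀ ≠ 0 := by
    intro h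
    rw [mossIndex, if_pos h] at hidx
    exact absurd hidx (not_le.2 (EReal.coe_lt_top _))
  rw [mossIndex_of_pullCount_ne_zero n _ a₀ hN0', EReal.coe_le_coe_iff] at hidx
  have hz := hZ t hN0'
  have hb : bonus m (pullCount w a) ≤ D / 4 := by
    refine (bonus_le hmpos hNpos).trans ?_
    rw [div_le_iff₀ hDpos] at hN
    rw [div_le_iff₀ hNpos]
    linarith
  have hμ : μ a = m₀ - D := by rw [hD]; ring
  change D / 4 ≤ empMean w a - μ a
  rw [← hw] at hz
  linarith

/-! ### Measurability, and the deficit of the comparator's index. -/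

theorem measurable_pullCount {K t : ℕ} (a : Fin K) :
    Measurable fun u : Fin t → Fin K × ℝ => pullCount u a := by
  unfold pullCount
  simp only [Finset.card_filter]
  exact Finset.measurable_sum _ fun s _ => Measurable.ite
    (measurableSet_eq_fun (by fun_prop) measurable_const) measurable_const measurable_const

theorem measurable_pullCount_real {K t : ℕ} (a : Fin K) :
    Measurable fun u : Fin t → Fin K × ℝ => (pullCount u a : ℝ) :=
  (measurable_from_nat (f := fun k : ℕ => (k : ℝ))).comp (measurable_pullCount a)

theorem measurable_empMean {K t : ℕ} (a : Fin K) :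
    Measurable fun u : Fin t → Fin K × ℝ => empMean u a := by
  unfold empMean
  exact (Finset.measurable_sum _ fun s _ => Measurable.ite
    (measurableSet_eq_fun (by fun_prop) measurable_const) (by fun_prop) measurable_const).div
    (measurable_pullCount_real a)

theorem ofReal_sum_le {ι : Type*} (s : Finset ι) (f : ι → ℝ) :
    ENNReal.ofReal (∑ i ∈ s, f i) ≤ ∑ i ∈ s, ENNReal.ofReal (f i) :=
  Finset.le_sum_of_subadditive ENNReal.ofReal ENNReal.ofReal_zero.le
    (fun _ _ => ENNReal.ofReal_add_le) s f

/-- The pairs (arm, reward) seen before round `t`. -/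
def past {K n : ℕ} (t : Fin n) (h : Fin n → Fin K × I × ℝ) : Fin t → Fin K × ℝ :=
  Fin.take t t.is_lt.le (seen h)

theorem measurable_past {K n : ℕ} (t : Fin n) :
    Measurable (past t : (Fin n → Fin K × I × ℝ) → Fin t → Fin K × ℝ) :=
  (measurable_finTake _).comp measurable_seen

/-- The largest amount by which the index of `a` falls below `m₀`. -/
def underestimation {K n : ℕ} (a : Fin K) (m₀ : ℝ) (h : Fin n → Fin K × I × ℝ) : ℝ :=
  -- Before the first pull the index is +∞; the value 0 used there does not affect events `x <
  -- underestimation` with x ≥ 0.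
  ⨆ t : Fin n, if pullCount (past t h) a = 0 then 0
    else m₀ - (empMean (past t h) a + bonus ((n : ℝ) / K) (pullCount (past t h) a))

theorem measurable_underestimation {K n : ℕ} (a : Fin K) (m₀ : ℝ) :
    Measurable (underestimation a m₀ : (Fin n → Fin K × I × ℝ) → ℝ) := by
  refine Measurable.iSup fun t => ?_
  have h1 := (measurable_pullCount (K := K) (t := t) a).comp (measurable_past t)
  have h2 := (measurable_pullCount_real (K := K) (t := t) a).comp (measurable_past t)
  have h3 := (measurable_empMean (K := K) (t := t) a).comp (measurable_past t)
  refine Measurable.ite (h1 (measurableSet_singleton 0)) measurable_const ?_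
  unfold bonus
  exact measurable_const.sub (h3.add
    (((Real.measurable_log.comp (measurable_const.div h2)).max measurable_const).div h2).sqrt)

theorem le_underestimation {K n : ℕ} (a : Fin K) (m₀ : ℝ) (h : Fin n → Fin K × I × ℝ) (t : Fin n)
    (ht : pullCount (past t h) a ≠ 0) :
    m₀ - (empMean (past t h) a + bonus ((n : ℝ) / K) (pullCount (past t h) a)) ≤
      underestimation a m₀ h := by
  have := le_ciSup (f := fun t : Fin n => if pullCount (past t h) a = 0 then 0
    else m₀ - (empMean (past t h) a + bonus ((n : ℝ) / K) (pullCount (past t h) a)))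
    (Set.finite_range _).bddAbove t
  rw [if_neg ht] at this
  exact this

theorem exists_of_lt_underestimation {K n : ℕ} (hn : 0 < n) {a : Fin K} {m₀ x : ℝ} (hx : 0 ≤ x)
    {h : Fin n → Fin K × I × ℝ} (hlt : x < underestimation a m₀ h) :
    ∃ t : Fin n, pullCount (past t h) a ≠ 0 ∧
      x < m₀ - (empMean (past t h) a + bonus ((n : ℝ) / K) (pullCount (past t h) a)) := by
  have : Nonempty (Fin n) := ⟨⟨0, hn⟩⟩
  obtain ⟨t, ht⟩ := exists_lt_of_lt_ciSup hlt
  by_cases h0 : pullCount (past t h) a = 0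
  · rw [if_pos h0] at ht
    exact absurd ht (not_lt.2 hx)
  · exact ⟨t, h0, by simpa [h0] using ht⟩

/-- If the index after `N ∈ [2 ^ j, 2 ^ (j + 1))` pulls falls below the mean by more than `x`, then
the exponential tilt attached to the block `j` is large. -/
theorem block_tilt {m x N d : ℝ} {j : ℕ} (hm : 0 < m) (hx : 0 < x) (h1 : 2 ^ j ≤ N)
    (h2 : N ≤ 2 ^ (j + 1)) (hd : x + bonus m N < d) {l : ℝ}
    (hl : l = 2 * (2 ^ j * x + √(2 ^ j * max (Real.log (m / 2 ^ (j + 1))) 0)) / 2 ^ j) :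
    2 ^ j * x ^ 2 + max (Real.log (m / 2 ^ (j + 1))) 0 ≤ N * (l * d - l ^ 2 / 8) := by
  set p : ℝ := 2 ^ j with hp
  have hp0 : 0 < p := by positivity
  have hN : 0 < N := hp0.trans_le h1
  rw [pow_succ 2 j, ← hp] at h2 hl ⊢
  set w := max (Real.log (m / (p * 2))) 0 with hw
  have hw0 : 0 ≤ w := le_max_right _ _
  set r := √(p * w) with hr
  have hr0 : 0 ≤ r := Real.sqrt_nonneg _
  have hr2 : r ^ 2 = p * w := Real.sq_sqrt (by positivity)
  -- `w` is computed at the right end of the block, hence is a lower bound for the logarithm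
  -- throughout the block.
  have hlog : w ≤ max (Real.log (m / N)) 0 := by
    refine max_le_max (Real.log_le_log (by positivity) ?_) le_rfl
    gcongr
  have hb : r ≤ N * bonus m N := by
    have : N * bonus m N = √(N * max (Real.log (m / N)) 0) := by
      unfold bonus
      rw [← Real.sqrt_sq hN.le, ← Real.sqrt_mul (sq_nonneg N), Real.sqrt_sq hN.le]
      congr 1
      field_simp
    rw [this]
    exact Real.sqrt_le_sqrt (mul_le_mul h1 hlog hw0 hN.le)
  have hNd : p * x + r ≤ N * d := by
    have h3 : N * (x + bonus m N) ≤ N * d := mul_le_mul_of_nonneg_left hd.le hN.le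
    have h4 : p * x ≤ N * x := mul_le_mul_of_nonneg_right h1 hx.le
    linarith
  have hl0 : 0 ≤ l := by rw [hl]; positivity
  have h5 : l * (p * x + r) ≤ l * (N * d) := mul_le_mul_of_nonneg_left hNd hl0
  have h6 : N * (l ^ 2 / 8) ≤ p * 2 * (l ^ 2 / 8) := by gcongr
  -- `l` is the maximizer of the left-hand side, a quadratic in which N has been replaced by its
  -- upper bound 2p.
  have h7 : l * (p * x + r) - p * 2 * (l ^ 2 / 8) = (p * x + r) ^ 2 / p := by
    rw [hl]; field_simp; ring
  have h8 : p * x ^ 2 + w ≤ (p * x + r) ^ 2 / p := by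
    rw [le_div_iff₀ hp0]
    nlinarith [mul_nonneg (mul_nonneg hp0.le hx.le) hr0]
  linarith

/-! ### Deviation bounds and the expected regret of MOSS. -/

section Law

variable {K : ℕ} (π : Kernel (Fin K) I) (A : DiscreteAlgorithm K) (ν : Kernel I ℝ)
variable [IsMarkovKernel π] [IsMarkovKernel ν]

/-- Ville's inequality for the supermartingale of `prod_tilt`: uniformity over the rounds costs no
union bound. -/
theorem measure_exists_tilt_le (a : Fin K) {l μ v : ℝ} (c : ℝ)
    (hG : ∫⁻ q, ENNReal.ofReal (Real.exp (l * (q.2 - μ) - v)) ∂(pieceLaw π ν a) ≤ 1) (n : ℕ) :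
    cabLaw π A ν n {h | ∃ t : Fin n,
      c ≤ pullCount (past t h) a * (l * (empMean (past t h) a - μ) - v)} ≤
        ENNReal.ofReal (Real.exp (-c)) := by
  classical
  let G : Fin K × I × ℝ → ENNReal := fun q =>
    if q.1 = a then ENNReal.ofReal (Real.exp (l * (q.2.2 - μ) - v)) else 1
  have hGm : Measurable G := by
    refine Measurable.ite (measurableSet_eq_fun (by fun_prop) measurable_const) ?_ measurable_const
    fun_prop
  have hG1 : ∀ i, ∫⁻ q, G (i, q) ∂(pieceLaw π ν i) ≤ 1 := by
    intro i
    by_cases hi : i = a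
    · subst hi; simpa [G] using hG
    · simp [G, hi]
  have := measure_exists_le_prod π A ν hGm hG1 (ENNReal.ofReal (Real.exp c)) n
  rw [← ENNReal.ofReal_inv_of_pos (Real.exp_pos c), ← Real.exp_neg] at this
  refine (measure_mono ?_).trans this
  rintro h ⟨t, ht⟩
  refine ⟨t.castSucc, ?_⟩
  have h1 := prod_tilt (past t h) a l μ v
  calc ENNReal.ofReal (Real.exp c) ≤ _ := ENNReal.ofReal_le_ofReal (Real.exp_le_exp.2 ht)
    _ = _ := h1.symm
    _ = _ := rfl

/-- Tail of the underestimation of the comparator, by peeling over dyadic numbers of pulls. -/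
theorem measure_lt_underestimation {n : ℕ} (hn : 0 < n) {a : Fin K} {m₀ : ℝ}
    (hlow : ∀ l : ℝ, 0 ≤ l → ∫⁻ q, ENNReal.ofReal (Real.exp (-l * (q.2 - m₀) - l ^ 2 / 8))
      ∂(pieceLaw π ν a) ≤ 1) {x : ℝ} (hx : 0 < x) :
    cabLaw π A ν n {h | x < underestimation a m₀ h} ≤
      ENNReal.ofReal (4 / ((n : ℝ) / K) / x ^ 2) := by
  have hK : 0 < K := a.pos
  set m : ℝ := (n : ℝ) / K with hm
  have hm0 : 0 < m := by positivity
  let w : ℕ → ℝ := fun j => max (Real.log (m / 2 ^ (j + 1))) 0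
  let l : ℕ → ℝ := fun j => 2 * (2 ^ j * x + √(2 ^ j * w j)) / 2 ^ j
  have hl : ∀ j, 0 ≤ l j := fun j => by positivity
  have hsub : {h : Fin n → Fin K × I × ℝ | x < underestimation a m₀ h} ⊆
      ⋃ j ∈ Finset.range n, {h | ∃ t : Fin n, 2 ^ j * x ^ 2 + w j ≤
        pullCount (past t h) a * (-l j * (empMean (past t h) a - m₀) - l j ^ 2 / 8)} := by
    intro h hh
    obtain ⟨t, ht0, ht⟩ := exists_of_lt_underestimation hn hx.le hh
    set N := pullCount (past t h) a with hN
    have hNt : N < n := (pullCount_le _ a).trans_lt t.is_lt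
    refine mem_iUnion₂.2 ⟨Nat.log 2 N, Finset.mem_range.2 ((Nat.log_le_self 2 N).trans_lt hNt),
      t, ?_⟩
    have h1 : (2 : ℝ) ^ Nat.log 2 N ≤ N := by exact_mod_cast Nat.pow_log_le_self 2 ht0
    have h2 : (N : ℝ) ≤ 2 ^ (Nat.log 2 N + 1) := by
      exact_mod_cast (Nat.lt_pow_succ_log_self (by norm_num) N).le
    have h3 := block_tilt (d := m₀ - empMean (past t h) a) (l := l (Nat.log 2 N)) hm0 hx h1 h2
      (by rw [← hm] at ht; linarith) rfl
    refine h3.trans (le_of_eq ?_)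
    ring
  refine (measure_mono hsub).trans ((measure_biUnion_finset_le _ _).trans ?_)
  have hj : ∀ j ∈ Finset.range n, cabLaw π A ν n {h | ∃ t : Fin n, 2 ^ j * x ^ 2 + w j ≤
        pullCount (past t h) a * (-l j * (empMean (past t h) a - m₀) - l j ^ 2 / 8)} ≤
      ENNReal.ofReal (2 / m * (2 ^ j * Real.exp (-(2 ^ j * x ^ 2)))) := by
    intro j _
    refine (measure_exists_tilt_le π A ν a _ (hlow (l j) (hl j)) n).trans ?_
    refine ENNReal.ofReal_le_ofReal ?_
    -- The logarithm in the bonus becomes a weight proportional to 2^j / m, which keeps the sum over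
    -- blocks of order 1/(m x²).
    have h1 : Real.exp (-w j) ≤ 2 ^ (j + 1) / m := by
      have : -w j ≤ Real.log (2 ^ (j + 1) / m) := by
        rw [← inv_div, Real.log_inv, neg_le_neg_iff]
        exact le_max_left _ _
      exact (Real.exp_le_exp.2 this).trans_eq (Real.exp_log (by positivity))
    rw [neg_add, Real.exp_add]
    calc _ ≤ Real.exp (-(2 ^ j * x ^ 2)) * (2 ^ (j + 1) / m) := by gcongr
      _ = _ := by rw [pow_succ]; ring
  refine (Finset.sum_le_sum hj).trans ?_
  rw [← ENNReal.ofReal_sum_of_nonneg (fun _ _ => by positivity), ← Finset.mul_sum]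
  refine ENNReal.ofReal_le_ofReal ?_
  calc _ ≤ 2 / m * (2 / x ^ 2) := by
        gcongr
        exact sum_two_pow_mul_exp_le (by positivity) n
    _ = _ := by ring

theorem lintegral_underestimation {n : ℕ} (hn : 0 < n) {a : Fin K} {m₀ : ℝ}
    (hlow : ∀ l : ℝ, 0 ≤ l → ∫⁻ q, ENNReal.ofReal (Real.exp (-l * (q.2 - m₀) - l ^ 2 / 8))
      ∂(pieceLaw π ν a) ≤ 1) {δ : ℝ} (hδ : 0 < δ) :
    ∫⁻ h, ENNReal.ofReal (max (underestimation a m₀ h - δ) 0) ∂(cabLaw π A ν n) ≤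
      ENNReal.ofReal (4 / ((n : ℝ) / K) / δ) := by
  have hm : Measurable fun h : Fin n → Fin K × I × ℝ => max (underestimation a m₀ h - δ) 0 :=
    ((measurable_underestimation a m₀).sub_const δ).max measurable_const
  have hn0 : 0 ≤ᵐ[cabLaw π A ν n] fun h => max (underestimation a m₀ h - δ) 0 :=
    Filter.Eventually.of_forall fun h => le_max_right _ _
  rw [lintegral_eq_lintegral_meas_lt _ hn0 hm.aemeasurable, ← lintegral_Ioi_inv_sq hδ (by positivity)]
  refine setLIntegral_mono' measurableSet_Ioi fun x hx => ?_
  have hx' : 0 < x := hx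
  refine (measure_mono ?_).trans (measure_lt_underestimation π A ν hn hlow (add_pos hx' hδ))
  intro h hh
  have hh' : x < max (underestimation a m₀ h - δ) 0 := hh
  rcases lt_max_iff.1 hh' with h1 | h1
  · change x + δ < _
    linarith
  · exact absurd h1 (not_lt.2 hx'.le)

/-- The empirical mean of `a` after `s` pulls exceeds `μ` by at least `d`. -/
def overestimated {n : ℕ} (a : Fin K) (μ d : ℝ) (s : ℕ) : Set (Fin n → Fin K × I × ℝ) :=
  {h | ∃ t : Fin n, pullCount (past t h) a = s ∧ d ≤ empMean (past t h) a - μ}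

theorem measurableSet_overestimated {n : ℕ} (a : Fin K) (μ d : ℝ) (s : ℕ) :
    MeasurableSet (overestimated (n := n) a μ d s) := by
  unfold overestimated
  rw [ofPred_exists]
  refine MeasurableSet.iUnion fun t => ?_
  exact (((measurable_pullCount a).comp (measurable_past t)) (measurableSet_singleton s)).inter
    (measurableSet_le measurable_const
      (((measurable_empMean a).comp (measurable_past t)).sub_const μ))

theorem measure_overestimated_le {n : ℕ} {a : Fin K} {μ : ℝ}
    (hup : ∀ l : ℝ, ∫⁻ q, ENNReal.ofReal (Real.exp (l * (q.2 - μ) - l ^ 2 / 4))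
      ∂(pieceLaw π ν a) ≤ 1) {d : ℝ} (hd : 0 ≤ d) (s : ℕ) :
    cabLaw π A ν n (overestimated a μ d s) ≤ ENNReal.ofReal (Real.exp (-(s * d ^ 2))) := by
  -- The tilt l = 2d maximizes l d - l²/4, with value d².
  refine (measure_mono ?_).trans (measure_exists_tilt_le π A ν a (s * d ^ 2) (hup (2 * d)) n)
  rintro h ⟨t, ht, htd⟩
  refine ⟨t, ?_⟩
  rw [ht]
  have : d * d ≤ d * (empMean (past t h) a - μ) := mul_le_mul_of_nonneg_left htd hd
  have hs : (0 : ℝ) ≤ s := by positivity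
  refine mul_le_mul_of_nonneg_left ?_ hs
  nlinarith

/-- Distribution-free bound on the pseudo-regret of MOSS with respect to the level `m₀`. -/
theorem lintegral_sum_gap_le {n : ℕ} (hn : 0 < n) (hA : A.IsMOSS n) {a₀ : Fin K} {m₀ : ℝ}
    {μ : Fin K → ℝ} (hμ : ∀ a, m₀ - μ a ≤ 1)
    (hlow : ∀ l : ℝ, 0 ≤ l → ∫⁻ q, ENNReal.ofReal (Real.exp (-l * (q.2 - m₀) - l ^ 2 / 8))
      ∂(pieceLaw π ν a₀) ≤ 1)
    (hup : ∀ a, ∀ l : ℝ, ∫⁻ q, ENNReal.ofReal (Real.exp (l * (q.2 - μ a) - l ^ 2 / 4))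
      ∂(pieceLaw π ν a) ≤ 1) :
    ∫⁻ h, ENNReal.ofReal (∑ t, (m₀ - μ (h t).1)) ∂(cabLaw π A ν n) ≤
      ENNReal.ofReal (16 * √(n * K) + K) := by
  classical
  have hK : 0 < K := a₀.pos
  have hKr : (0 : ℝ) < K := by exact_mod_cast hK
  have hnr : (0 : ℝ) < n := by exact_mod_cast hn
  set m : ℝ := (n : ℝ) / K with hm
  have hm0 : 0 < m := by positivity
  have hsm : 0 < √m := Real.sqrt_pos.2 hm0
  have hsm2 : √m * √m = m := Real.mul_self_sqrt hm0.le
  -- With this threshold, small gaps and underestimation cost 4K√m each, and each piece costs 8√m +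
  -- 1; in total 16K√m + K, where K√m = √(nK).
  set Δ₀ : ℝ := 4 / √m with hΔ₀
  have hΔ₀pos : 0 < Δ₀ := by positivity
  have hR : √((n : ℝ) * K) = K * √m := by
    rw [← Real.sqrt_sq hKr.le, ← Real.sqrt_mul (sq_nonneg _), Real.sqrt_sq hKr.le]
    congr 1; rw [hm]; field_simp
  let U : (Fin n → Fin K × I × ℝ) → ENNReal := fun h =>
    ENNReal.ofReal (n * Δ₀) + ENNReal.ofReal (2 * n) *
      ENNReal.ofReal (max (underestimation a₀ m₀ h - Δ₀ / 2) 0) +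
    ∑ a, if Δ₀ < m₀ - μ a then ENNReal.ofReal (4 * √m + 1) + ENNReal.ofReal (m₀ - μ a) *
      ∑ s ∈ Finset.range n,
        (overestimated a (μ a) ((m₀ - μ a) / 4) (s + 1)).indicator (fun _ => 1) h else 0
  have hpath : ∀ᵐ h ∂(cabLaw π A ν n), ENNReal.ofReal (∑ t, (m₀ - μ (h t).1)) ≤ U h := by
    filter_upwards [ae_maximal_index π A ν hA n] with h hh
    have h1 := sum_gap_le hK hn (seen h) hh a₀ m₀ (underestimation a₀ m₀ h) μ hΔ₀pos
      (fun t ht => le_underestimation a₀ m₀ h t ht)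
    refine (ENNReal.ofReal_le_ofReal h1).trans ?_
    refine ENNReal.ofReal_add_le.trans ?_
    refine add_le_add ?_ ?_
    · rw [← ENNReal.ofReal_mul (by positivity), ← ENNReal.ofReal_add (by positivity)
        (by positivity)]
      exact ENNReal.ofReal_le_ofReal (by linarith)
    · refine (ofReal_sum_le _ _).trans (Finset.sum_le_sum fun a _ => ?_)
      by_cases ha : Δ₀ < m₀ - μ a
      swap
      · simp [ha]
      simp only [ha, if_true]
      have hD : 0 < m₀ - μ a := hΔ₀pos.trans ha
      rw [mul_add]
      refine ENNReal.ofReal_add_le.trans (add_le_add (ENNReal.ofReal_le_ofReal ?_) ?_)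
      · rw [mul_add, mul_div_cancel₀ _ hD.ne', mul_one]
        have := hμ a
        linarith
      · rw [ENNReal.ofReal_mul hD.le]
        gcongr
        refine (ofReal_sum_le _ _).trans (Finset.sum_le_sum fun s _ => ?_)
        by_cases hE : h ∈ overestimated a (μ a) ((m₀ - μ a) / 4) (s + 1)
        · rw [indicator_of_mem hE]
          split_ifs <;> simp
        · rw [indicator_of_notMem hE]
          split_ifs with hc
          · exact absurd hc hE
          · simp
  refine (lintegral_mono_ae hpath).trans ?_
  have hmu : Measurable fun h : Fin n → Fin K × I × ℝ =>
      ENNReal.ofReal (max (underestimation a₀ m₀ h - Δ₀ / 2) 0) :=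
    ((((measurable_underestimation a₀ m₀).sub_const _).max measurable_const)).ennreal_ofReal
  have hmi : ∀ a s, Measurable ((overestimated (n := n) a (μ a) ((m₀ - μ a) / 4)
      (s + 1)).indicator (fun _ => (1 : ENNReal))) := fun a s =>
    measurable_const.indicator (measurableSet_overestimated a _ _ _)
  have hms : ∀ a, Measurable fun h : Fin n → Fin K × I × ℝ => ∑ s ∈ Finset.range n,
        (overestimated a (μ a) ((m₀ - μ a) / 4) (s + 1)).indicator (fun _ => (1 : ENNReal)) h :=
    fun a => Finset.measurable_sum _ fun s _ => hmi a s
  have harm : ∀ a, ∫⁻ h, (if Δ₀ < m₀ - μ a then ENNReal.ofReal (4 * √m + 1) +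
      ENNReal.ofReal (m₀ - μ a) * ∑ s ∈ Finset.range n,
        (overestimated a (μ a) ((m₀ - μ a) / 4) (s + 1)).indicator (fun _ => 1) h else 0)
        ∂(cabLaw π A ν n) ≤ ENNReal.ofReal (8 * √m + 1) := by
    intro a
    by_cases ha : Δ₀ < m₀ - μ a
    swap
    · simp [ha]
    simp only [ha, if_true]
    have hD : 0 < m₀ - μ a := hΔ₀pos.trans ha
    rw [lintegral_add_left measurable_const, lintegral_const_mul _ (hms a),
      lintegral_finsetSum _ fun s _ => hmi a s]
    simp only [lintegral_const, measure_univ, mul_one]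
    have h1 : ∑ s ∈ Finset.range n, ∫⁻ h,
        (overestimated a (μ a) ((m₀ - μ a) / 4) (s + 1)).indicator (fun _ => 1) h
        ∂(cabLaw π A ν n) ≤ ENNReal.ofReal (16 / (m₀ - μ a) ^ 2) := by
      calc _ ≤ ∑ s ∈ Finset.range n,
            ENNReal.ofReal (Real.exp (-(((s : ℝ) + 1) * ((m₀ - μ a) / 4) ^ 2))) := by
            refine Finset.sum_le_sum fun s _ => ?_
            rw [lintegral_indicator_const (measurableSet_overestimated a _ _ _), one_mul]
            have := measure_overestimated_le π A ν (n := n) (hup a)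
              (d := (m₀ - μ a) / 4) (by positivity) (s + 1)
            push_cast at this
            exact this
        _ ≤ _ := by
            rw [← ENNReal.ofReal_sum_of_nonneg (fun _ _ => (Real.exp_pos _).le)]
            refine ENNReal.ofReal_le_ofReal ((sum_exp_neg_mul_le (by positivity) n).trans ?_)
            rw [div_pow, one_div_div]
            norm_num
    calc _ ≤ ENNReal.ofReal (4 * √m + 1) +
          ENNReal.ofReal (m₀ - μ a) * ENNReal.ofReal (16 / (m₀ - μ a) ^ 2) := by gcongr
      _ ≤ _ := by
        rw [← ENNReal.ofReal_mul hD.le, ← ENNReal.ofReal_add (by positivity) (by positivity)]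
        refine ENNReal.ofReal_le_ofReal ?_
        have h2 : (m₀ - μ a) * (16 / (m₀ - μ a) ^ 2) = 16 / (m₀ - μ a) := by field_simp
        have h3 : 16 / (m₀ - μ a) ≤ 16 / Δ₀ := by gcongr
        have h4 : 16 / Δ₀ = 4 * √m := by rw [hΔ₀]; field_simp; norm_num
        linarith
  have hmarm : ∀ a, Measurable fun h : Fin n → Fin K × I × ℝ =>
      if Δ₀ < m₀ - μ a then ENNReal.ofReal (4 * √m + 1) +
      ENNReal.ofReal (m₀ - μ a) * ∑ s ∈ Finset.range n,
        (overestimated a (μ a) ((m₀ - μ a) / 4) (s + 1)).indicator (fun _ => 1) h else 0 := by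
    intro a
    split_ifs
    · exact measurable_const.add ((hms a).const_mul _)
    · exact measurable_const
  have hmd : Measurable fun h : Fin n → Fin K × I × ℝ => ENNReal.ofReal (n * Δ₀) +
      ENNReal.ofReal (2 * n) * ENNReal.ofReal (max (underestimation a₀ m₀ h - Δ₀ / 2) 0) :=
    measurable_const.add (hmu.const_mul _)
  simp only [U]
  rw [lintegral_add_left hmd,
    lintegral_add_left measurable_const, lintegral_const_mul _ hmu,
    lintegral_finsetSum _ fun a _ => hmarm a]
  simp only [lintegral_const, measure_univ, mul_one]
  calc _ ≤ ENNReal.ofReal (n * Δ₀) + ENNReal.ofReal (2 * n) * ENNReal.ofReal (4 / m / (Δ₀ / 2)) +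
        ∑ a : Fin K, ENNReal.ofReal (8 * √m + 1) := by
        gcongr with a _
        · exact lintegral_underestimation π A ν hn hlow (by positivity)
        · exact harm a
    _ = ENNReal.ofReal (n * Δ₀ + 2 * n * (4 / m / (Δ₀ / 2)) + K * (8 * √m + 1)) := by
        rw [Finset.sum_const, Finset.card_univ, Fintype.card_fin, nsmul_eq_mul,
          ← ENNReal.ofReal_natCast K, ← ENNReal.ofReal_mul (by positivity),
          ← ENNReal.ofReal_mul (by positivity), ← ENNReal.ofReal_add (by positivity)
          (by positivity), ← ENNReal.ofReal_add (by positivity) (by positivity)]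
    _ ≤ _ := by
        refine ENNReal.ofReal_le_ofReal (le_of_eq ?_)
        have hnm : (n : ℝ) = K * (√m * √m) := by rw [hsm2, hm]; field_simp
        have h5 : 4 / m / (Δ₀ / 2) = 2 / √m := by
          rw [hΔ₀, ← hsm2]; field_simp; norm_num
        rw [hR, h5, hΔ₀, hnm]
        field_simp
        ring

end Law

/-! ### Simple regret of CAB1.1 with the uniform discretization. -/

theorem volume_cell {K : ℕ} (i : Fin K) :
    (volume : Measure I) {x : I | (i : ℝ) / K ≤ x ∧ (x : ℝ) ≤ ((i : ℝ) + 1) / K} ≠ 0 := by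
  have hK : (0 : ℝ) < K := by exact_mod_cast i.pos
  have hi : (i : ℝ) + 1 ≤ K := by exact_mod_cast i.is_lt
  have h1 : (i : ℝ) / K ∈ I := ⟨by positivity, by rw [div_le_one hK]; linarith⟩
  have h2 : ((i : ℝ) + 1) / K ∈ I := ⟨by positivity, by rwa [div_le_one hK]⟩
  have : {x : I | (i : ℝ) / K ≤ x ∧ (x : ℝ) ≤ ((i : ℝ) + 1) / K} =
      Icc (⟨_, h1⟩ : I) ⟨_, h2⟩ := by
    ext x; rfl
  rw [this, unitInterval.volume_Icc, ne_eq, ENNReal.ofReal_eq_zero, not_le, sub_pos]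
  change (i : ℝ) / K < ((i : ℝ) + 1) / K
  gcongr
  linarith

instance isMarkovKernel_disc (K : ℕ) : IsMarkovKernel (disc K) :=
  ⟨fun i => cond_isProbabilityMeasure (volume_cell i)⟩

theorem ae_disc {K : ℕ} (i : Fin K) :
    ∀ᵐ x ∂(disc K i), (i : ℝ) / K ≤ ((x : I) : ℝ) ∧ (x : ℝ) ≤ ((i : ℝ) + 1) / K := by
  have hm : MeasurableSet {x : I | (i : ℝ) / K ≤ x ∧ (x : ℝ) ≤ ((i : ℝ) + 1) / K} :=
    (measurableSet_le measurable_const measurable_subtype_coe).inter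
      (measurableSet_le measurable_subtype_coe measurable_const)
  exact ae_cond_mem hm

theorem exists_cell {K : ℕ} (hK : 0 < K) (x : I) :
    ∃ i : Fin K, (i : ℝ) / K ≤ x ∧ (x : ℝ) ≤ ((i : ℝ) + 1) / K := by
  have hKr : (0 : ℝ) < K := by exact_mod_cast hK
  have hx0 : 0 ≤ (x : ℝ) * K := mul_nonneg x.2.1 hKr.le
  -- At x = 1 the floor of x K is K, which is not a valid index; the last cell is used instead.
  rcases eq_or_lt_of_le x.2.2 with h1 | h1
  · refine ⟨⟨K - 1, by omega⟩, ?_⟩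
    have : ((K - 1 : ℕ) : ℝ) = K - 1 := by rw [Nat.cast_sub hK]; simp
    simp only [this, h1]
    constructor
    · rw [div_le_one hKr]; linarith
    · rw [sub_add_cancel, div_self hKr.ne']
  · refine ⟨⟨⌊(x : ℝ) * K⌋₊, ?_⟩, ?_, ?_⟩
    · rw [Nat.floor_lt hx0]
      nlinarith
    · rw [div_le_iff₀ hKr]
      exact Nat.floor_le hx0
    · rw [le_div_iff₀ hKr]
      exact (Nat.lt_floor_add_one _).le

theorem lintegral_exp_le_of_hasSubgaussianMGF {Ω : Type*} [MeasurableSpace Ω] {P : Measure Ω}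
    {X : Ω → ℝ} {c : ℝ≥0} (h : HasSubgaussianMGF X c P) (t : ℝ) :
    ∫⁻ ω, ENNReal.ofReal (Real.exp (t * X ω)) ∂P ≤ ENNReal.ofReal (Real.exp (c * t ^ 2 / 2)) := by
  rw [← ofReal_integral_eq_lintegral_ofReal (h.integrable_exp_mul t)
    (Filter.Eventually.of_forall fun _ => (Real.exp_pos _).le)]
  exact ENNReal.ofReal_le_ofReal (h.mgf_le t)

section Environment

variable {ν : Kernel I ℝ} {f : I → ℝ}

theorem IsEnvironment.measurable (hν : IsEnvironment ν f) : Measurable f := by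
  have : f = fun x => ∫ y, y ∂(ν x) := funext fun x => (hν.mean x).symm
  rw [this]
  exact (stronglyMeasurable_id.integral_kernel).measurable

theorem IsEnvironment.lintegral_exp_le (hν : IsEnvironment ν f) (x : I) (t : ℝ) :
    ∫⁻ y, ENNReal.ofReal (Real.exp (t * (y - f x))) ∂(ν x) ≤
      ENNReal.ofReal (Real.exp (t ^ 2 / 8)) := by
  refine (lintegral_exp_le_of_hasSubgaussianMGF (hν.subgaussian x) t).trans_eq ?_
  congr 2
  push_cast
  ring

variable {K : ℕ} (π : Kernel (Fin K) I) [IsMarkovKernel π]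

theorem lintegral_pieceLaw [IsMarkovKernel ν] (i : Fin K) {g : I × ℝ → ENNReal}
    (hg : Measurable g) :
    ∫⁻ q, g q ∂(pieceLaw π ν i) = ∫⁻ x, ∫⁻ y, g (x, y) ∂(ν x) ∂(π i) := by
  unfold pieceLaw
  rw [Kernel.lintegral_compProd _ _ _ hg]
  rfl

/-- For a downward tilt, replacing `f x` by the smaller `m₀` only lowers the exponent. The spread of
f inside the piece thus costs nothing, and l²/8 suffices. -/
theorem IsEnvironment.lintegral_lower_tilt_le (hν : IsEnvironment ν f) {a : Fin K} {m₀ : ℝ}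
    (ha : ∀ᵐ x ∂(π a), m₀ ≤ f x) {l : ℝ} (hl : 0 ≤ l) :
    ∫⁻ q, ENNReal.ofReal (Real.exp (-l * (q.2 - m₀) - l ^ 2 / 8)) ∂(pieceLaw π ν a) ≤ 1 := by
  have := hν.markov
  rw [lintegral_pieceLaw π a (by fun_prop)]
  calc _ ≤ ∫⁻ _, 1 ∂(π a) := by
        refine lintegral_mono_ae ?_
        filter_upwards [ha] with x hx
        calc _ ≤ ∫⁻ y, ENNReal.ofReal (Real.exp (-(l ^ 2 / 8))) *
              ENNReal.ofReal (Real.exp (-l * (y - f x))) ∂(ν x) := by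
              refine lintegral_mono fun y => ?_
              rw [← ENNReal.ofReal_mul (Real.exp_pos _).le, ← Real.exp_add]
              refine ENNReal.ofReal_le_ofReal (Real.exp_le_exp.2 ?_)
              have := mul_le_mul_of_nonneg_left hx hl
              change -l * (y - m₀) - l ^ 2 / 8 ≤ _
              linarith
          _ ≤ ENNReal.ofReal (Real.exp (-(l ^ 2 / 8))) *
              ENNReal.ofReal (Real.exp ((-l) ^ 2 / 8)) := by
              rw [lintegral_const_mul _ (by fun_prop)]
              gcongr
              exact hν.lintegral_exp_le x (-l)
          _ = 1 := by
              rw [← ENNReal.ofReal_mul (Real.exp_pos _).le, ← Real.exp_add]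
              simp
    _ = 1 := by simp

/-- The noise of the reward around f(X) contributes l²/8, and the fluctuation of f(X) ∈ [0,1] around
its mean another l²/8 by Hoeffding's lemma. -/
theorem IsEnvironment.lintegral_tilt_le (hν : IsEnvironment ν f)
    (hf : ∀ x, f x ∈ Icc (0 : ℝ) 1) (a : Fin K) (l : ℝ) :
    ∫⁻ q, ENNReal.ofReal (Real.exp (l * (q.2 - ∫ x, f x ∂(π a)) - l ^ 2 / 4))
      ∂(pieceLaw π ν a) ≤ 1 := by
  have := hν.markov
  have hfm := hν.measurable
  set μ := ∫ x, f x ∂(π a)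
  rw [lintegral_pieceLaw π a (by fun_prop)]
  have hoeff : ∫⁻ x, ENNReal.ofReal (Real.exp (l * (f x - μ))) ∂(π a) ≤
      ENNReal.ofReal (Real.exp (l ^ 2 / 8)) := by
    refine (lintegral_exp_le_of_hasSubgaussianMGF (hasSubgaussianMGF_of_mem_Icc
      hfm.aemeasurable (Filter.Eventually.of_forall hf)) l).trans_eq ?_
    congr 2
    simp
    ring
  calc _ ≤ ∫⁻ x, ENNReal.ofReal (Real.exp (-(l ^ 2 / 8))) *
        ENNReal.ofReal (Real.exp (l * (f x - μ))) ∂(π a) := by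
        refine lintegral_mono fun x => ?_
        calc _ = ∫⁻ y, ENNReal.ofReal (Real.exp (l * (f x - μ) - l ^ 2 / 4)) *
              ENNReal.ofReal (Real.exp (l * (y - f x))) ∂(ν x) := by
              refine lintegral_congr fun y => ?_
              rw [← ENNReal.ofReal_mul (Real.exp_pos _).le, ← Real.exp_add]
              congr 2
              ring
          _ ≤ ENNReal.ofReal (Real.exp (l * (f x - μ) - l ^ 2 / 4)) *
              ENNReal.ofReal (Real.exp (l ^ 2 / 8)) := by
              rw [lintegral_const_mul _ (by fun_prop)]
              gcongr
              exact hν.lintegral_exp_le x l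
          _ = _ := by
              rw [← ENNReal.ofReal_mul (Real.exp_pos _).le,
                ← ENNReal.ofReal_mul (Real.exp_pos _).le, ← Real.exp_add, ← Real.exp_add]
              congr 2
              ring
    _ ≤ ENNReal.ofReal (Real.exp (-(l ^ 2 / 8))) * ENNReal.ofReal (Real.exp (l ^ 2 / 8)) := by
        rw [lintegral_const_mul _ (by fun_prop)]
        gcongr
    _ = 1 := by
        rw [← ENNReal.ofReal_mul (Real.exp_pos _).le, ← Real.exp_add]
        simp

theorem lintegral_uniformOn_univ_fin {n : ℕ} (g : Fin n → ENNReal) :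
    ∫⁻ s, g s ∂(uniformOn (univ : Set (Fin n))) = (n : ENNReal)⁻¹ * ∑ s, g s := by
  rw [uniformOn, ProbabilityTheory.cond, Measure.restrict_univ, lintegral_smul_measure, lintegral_count,
    Measure.count_univ, tsum_fintype]
  simp

theorem isProbabilityMeasure_uniformOn_fin {n : ℕ} (hn : 0 < n) :
    IsProbabilityMeasure (uniformOn (univ : Set (Fin n))) :=
  isProbabilityMeasure_uniformOn finite_univ ⟨⟨0, hn⟩, mem_univ _⟩

theorem measurable_played {K n : ℕ} :
    Measurable fun q : (Fin n → Fin K × I × ℝ) × Fin n => (q.1 q.2).2.1 :=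
  measurable_from_prod_countable_left fun s => by
    change Measurable fun h : Fin n → Fin K × I × ℝ => (h s).2.1
    fun_prop

theorem isProbabilityMeasure_recommendationLaw (A : DiscreteAlgorithm K) [IsMarkovKernel ν]
    {n : ℕ} (hn : 0 < n) : IsProbabilityMeasure (recommendationLaw π A ν n) := by
  have := isProbabilityMeasure_uniformOn_fin hn
  exact Measure.isProbabilityMeasure_map measurable_played.aemeasurable

theorem lintegral_recommendationLaw (A : DiscreteAlgorithm K) [IsMarkovKernel ν] {n : ℕ}
    {g : I → ENNReal} (hg : Measurable g) :
    n * ∫⁻ x, g x ∂(recommendationLaw π A ν n) = ∫⁻ h, ∑ s, g (h s).2.1 ∂(cabLaw π A ν n) := by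
  rcases Nat.eq_zero_or_pos n with rfl | hn
  · simp
  have := isProbabilityMeasure_uniformOn_fin hn
  have hgm : Measurable fun q : (Fin n → Fin K × I × ℝ) × Fin n => g (q.1 q.2).2.1 :=
    hg.comp measurable_played
  rw [recommendationLaw, lintegral_map hg measurable_played, lintegral_prod _ hgm.aemeasurable]
  simp only [lintegral_uniformOn_univ_fin]
  rw [lintegral_const_mul _ (Finset.measurable_sum _ fun s _ => by fun_prop), ← mul_assoc,
    ENNReal.mul_inv_cancel (by simpa using hn.ne') (ENNReal.natCast_ne_top n), one_mul]

theorem IsEnvironment.sub_integral_recommendationLaw_le (hν : IsEnvironment ν f)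
    (hf : ∀ x, f x ∈ Icc (0 : ℝ) 1) {A : DiscreteAlgorithm K} {n : ℕ} (hn : 0 < n)
    (hA : A.IsMOSS n) {a : Fin K} {m₀ : ℝ} (hm₀ : m₀ ≤ 1) (ha : ∀ᵐ x ∂(π a), m₀ ≤ f x) :
    m₀ - ∫ x, f x ∂(recommendationLaw π A ν n) ≤ (16 * √(n * K) + K) / n := by
  have := hν.markov
  have hfm := hν.measurable
  have hrec := isProbabilityMeasure_recommendationLaw (ν := ν) π A hn
  have hint : ∀ P : Measure I, IsProbabilityMeasure P → ENNReal.ofReal (∫ x, f x ∂P) =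
      ∫⁻ x, ENNReal.ofReal (f x) ∂P := by
    intro P _
    refine ofReal_integral_eq_lintegral_ofReal ?_ (Filter.Eventually.of_forall fun x => (hf x).1)
    exact Integrable.of_mem_Icc 0 1 hfm.aemeasurable (Filter.Eventually.of_forall hf)
  set μ : Fin K → ℝ := fun i => ∫ x, f x ∂(π i) with hμ
  have hμ0 : ∀ i, 0 ≤ μ i := fun i => integral_nonneg fun x => (hf x).1
  have hreg := lintegral_sum_gap_le π A ν hn hA (a₀ := a) (m₀ := m₀) (μ := μ)
    (fun i => by have := hμ0 i; linarith)
    (fun l hl => hν.lintegral_lower_tilt_le π ha hl) (fun i l => hν.lintegral_tilt_le π hf i l)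
  -- Given the piece, the arm played has mean payoff `μ`; this passes from the regret of pieces to
  -- that of arms.
  have hswap : ∫⁻ h, ∑ s, ENNReal.ofReal (f (h s).2.1) ∂(cabLaw π A ν n) =
      ∫⁻ h, ∑ s, ENNReal.ofReal (μ (h s).1) ∂(cabLaw π A ν n) := by
    refine lintegral_sum_congr π A ν (φ := fun q => ENNReal.ofReal (f q.2.1))
      (ψ := fun q => ENNReal.ofReal (μ q.1)) (by fun_prop) ?_ (fun i => ?_) n
    · exact ((measurable_of_countable μ).comp measurable_fst).ennreal_ofReal
    · rw [lintegral_pieceLaw π i (by fun_prop)]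
      simp only [lintegral_const, measure_univ, mul_one]
      exact (hint (π i) inferInstance).symm
  have hmμ : Measurable fun h : Fin n → Fin K × I × ℝ => ∑ s, ENNReal.ofReal (μ (h s).1) :=
    Finset.measurable_sum _ fun s _ => ((measurable_of_countable μ).comp
      (measurable_fst.comp (measurable_pi_apply s))).ennreal_ofReal
  have hmain : ENNReal.ofReal (n * m₀) ≤
      ENNReal.ofReal (n * ∫ x, f x ∂(recommendationLaw π A ν n) + (16 * √(n * K) + K)) := by
    calc ENNReal.ofReal (n * m₀) = ∫⁻ _, ENNReal.ofReal (n * m₀) ∂(cabLaw π A ν n) := by simp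
      _ ≤ ∫⁻ h, (∑ s, ENNReal.ofReal (μ (h s).1)) + ENNReal.ofReal (∑ t, (m₀ - μ (h t).1))
            ∂(cabLaw π A ν n) := by
          refine lintegral_mono fun h => ?_
          have : (n : ℝ) * m₀ = ∑ s, μ (h s).1 + ∑ t, (m₀ - μ (h t).1) := by
            rw [← Finset.sum_add_distrib]; simp
          rw [this]
          refine ENNReal.ofReal_add_le.trans ?_
          gcongr
          exact ofReal_sum_le _ _
      _ ≤ _ := by
          rw [lintegral_add_left hmμ, ← hswap,
            ← lintegral_recommendationLaw π A (g := fun x => ENNReal.ofReal (f x)) (by fun_prop),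
            ← hint _ hrec, ENNReal.ofReal_add
              (mul_nonneg (Nat.cast_nonneg _) (integral_nonneg fun x => (hf x).1)) (by positivity),
            ENNReal.ofReal_mul (Nat.cast_nonneg _), ENNReal.ofReal_natCast]
          gcongr
  have hnr : (0 : ℝ) < n := by exact_mod_cast hn
  rw [ENNReal.ofReal_le_ofReal_iff (add_nonneg (mul_nonneg hnr.le
    (integral_nonneg fun x => (hf x).1)) (by positivity))] at hmain
  rw [le_div_iff₀ hnr]
  linarith

/-- Simple regret of CAB1.1 with MOSS and the uniform discretization in `K` pieces. -/
theorem IsEnvironment.maxValue_sub_integral_recommendationLaw_le (hν : IsEnvironment ν f)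
    {L α : ℝ} (hα : 0 ≤ α) (hL : 0 ≤ L) (hf : f ∈ holderClass L α) (hK : 0 < K)
    {A : DiscreteAlgorithm K} {n : ℕ} (hn : 0 < n) (hA : A.IsMOSS n) :
    maxValue f - ∫ x, f x ∂(recommendationLaw (disc K) A ν n) ≤
      L * ((K : ℝ) ^ α)⁻¹ + 17 * √(K / n) := by
  obtain ⟨hf01, xs, hxs, hhold⟩ := hf
  have hKr : (0 : ℝ) < K := by exact_mod_cast hK
  have hnr : (0 : ℝ) < n := by exact_mod_cast hn
  have hM : maxValue f ≤ 1 := hxs ▸ (hf01 xs).2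
  have hη : 0 ≤ L * ((K : ℝ) ^ α)⁻¹ := by positivity
  -- If K ≤ n, then K/n ≤ √(K/n), whence 17 = 16 + 1. If K > n, the right-hand side exceeds 1.
  rcases le_or_gt (K : ℝ) n with hKn | hKn
  · obtain ⟨a, ha1, ha2⟩ := exists_cell hK xs
    have ha : ∀ᵐ x ∂(disc K a), maxValue f - L * ((K : ℝ) ^ α)⁻¹ ≤ f x := by
      filter_upwards [ae_disc a] with x hx
      have h1 := hhold x
      have h2 : |(xs : ℝ) - x| ≤ (K : ℝ)⁻¹ := by
        have : ((a : ℝ) + 1) / K = a / K + (K : ℝ)⁻¹ := by field_simp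
        rw [this] at ha2 hx
        rw [abs_le]
        constructor <;> linarith [hx.1, hx.2]
      have h3 : |(xs : ℝ) - x| ^ α ≤ ((K : ℝ) ^ α)⁻¹ := by
        rw [← Real.inv_rpow hKr.le]
        exact Real.rpow_le_rpow (abs_nonneg _) h2 hα
      have h4 := mul_le_mul_of_nonneg_left h3 hL
      have h5 := le_abs_self (f xs - f x)
      rw [← hxs]
      linarith
    have h := hν.sub_integral_recommendationLaw_le (disc K) hf01 hn hA (by linarith) ha
    have hr : (K : ℝ) / n ≤ 1 := (div_le_one hnr).2 hKn
    have h6 : √((n : ℝ) * K) / n = √(K / n) := by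
      rw [← Real.sqrt_sq hnr.le, ← Real.sqrt_div' _ (sq_nonneg _), Real.sqrt_sq hnr.le]
      congr 1
      field_simp
    have h7 : (K : ℝ) / n ≤ √(K / n) := by
      refine Real.le_sqrt_of_sq_le ?_
      have : (0 : ℝ) ≤ K / n := by positivity
      nlinarith
    rw [add_div, mul_div_assoc, h6] at h
    linarith
  · have h1 : 1 ≤ √((K : ℝ) / n) := by
      rw [Real.one_le_sqrt, one_le_div hnr]
      exact hKn.le
    have h2 : 0 ≤ ∫ x, f x ∂(recommendationLaw (disc K) A ν n) :=
      integral_nonneg fun x => (hf01 x).1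
    linarith

end Environment

/-! ### Selection of a branch by cross-validation. -/

section CrossValidation

variable {ν : Kernel I ℝ} {f : I → ℝ}

instance [IsMarkovKernel ν] (n : ℕ) : IsMarkovKernel (repeatPlay ν n) := by
  induction n with
  | zero => unfold repeatPlay; infer_instance
  | succ n ih =>
    unfold repeatPlay
    exact Kernel.IsMarkovKernel.map _ (measurable_finSnoc n)

theorem measurable_average (n : ℕ) : Measurable fun y : Fin n → ℝ => (∑ s, y s) / (n : ℝ) := by
  fun_prop

instance [IsMarkovKernel ν] (n : ℕ) : IsMarkovKernel (averageReward ν n) :=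
  Kernel.IsMarkovKernel.map _ (measurable_average n)

theorem IsEnvironment.lintegral_repeatPlay_le (hν : IsEnvironment ν f) (x : I) (l : ℝ) (n : ℕ) :
    ∫⁻ y, ENNReal.ofReal (Real.exp (l * ∑ s, (y s - f x))) ∂(repeatPlay ν n x) ≤
      ENNReal.ofReal (Real.exp (n * (l ^ 2 / 8))) := by
  have := hν.markov
  induction n with
  | zero => simp [repeatPlay]
  | succ n ih =>
    rw [repeatPlay, Kernel.map_apply _ (measurable_finSnoc n),
      lintegral_map (by fun_prop) (measurable_finSnoc n), Kernel.prod_apply,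
      lintegral_prod]
    swap
    · refine Measurable.aemeasurable ?_
      exact Measurable.comp (g := fun y : Fin (n + 1) → ℝ =>
        ENNReal.ofReal (Real.exp (l * ∑ s, (y s - f x)))) (by fun_prop) (measurable_finSnoc n)
    simp only [Fin.sum_univ_castSucc, Fin.snoc_castSucc, Fin.snoc_last]
    calc _ = ∫⁻ y : Fin n → ℝ, ENNReal.ofReal (Real.exp (l * ∑ s, (y s - f x))) *
          ∫⁻ z, ENNReal.ofReal (Real.exp (l * (z - f x))) ∂(ν x) ∂(repeatPlay ν n x) := by
          refine lintegral_congr fun y => ?_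
          rw [← lintegral_const_mul _ (by fun_prop)]
          refine lintegral_congr fun z => ?_
          rw [← ENNReal.ofReal_mul (Real.exp_pos _).le, ← Real.exp_add, mul_add]
      _ ≤ ∫⁻ y : Fin n → ℝ, ENNReal.ofReal (Real.exp (l * ∑ s, (y s - f x))) *
          ENNReal.ofReal (Real.exp (l ^ 2 / 8)) ∂(repeatPlay ν n x) := by
          gcongr
          exact hν.lintegral_exp_le x l
      _ ≤ ENNReal.ofReal (Real.exp (n * (l ^ 2 / 8))) *
          ENNReal.ofReal (Real.exp (l ^ 2 / 8)) := by
          rw [lintegral_mul_const _ (by fun_prop)]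
          gcongr
      _ = _ := by
          rw [← ENNReal.ofReal_mul (Real.exp_pos _).le, ← Real.exp_add]
          congr 2
          push_cast
          ring

theorem IsEnvironment.lintegral_averageReward_le (hν : IsEnvironment ν f) (x : I) (l : ℝ) {n : ℕ}
    (hn : 0 < n) :
    ∫⁻ y, ENNReal.ofReal (Real.exp (l * (y - f x))) ∂(averageReward ν n x) ≤
      ENNReal.ofReal (Real.exp (l ^ 2 / (8 * n))) := by
  have hnr : (n : ℝ) ≠ 0 := by exact_mod_cast hn.ne'
  rw [averageReward, Kernel.map_apply _ (measurable_average n),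
    lintegral_map (by fun_prop) (measurable_average n)]
  have h := hν.lintegral_repeatPlay_le x (l / n) n
  convert h using 2
  · funext y
    congr 2
    rw [Finset.sum_sub_distrib, Finset.sum_const, Finset.card_univ, Fintype.card_fin, nsmul_eq_mul]
    field_simp
  · congr 1
    field_simp

variable {T : ℕ} (G : GPO T)

theorem GPO.isProbabilityMeasure_branchLaw [IsMarkovKernel ν] (hn : 0 < phaseLength T)
    (i : Fin (numBranches T)) : IsProbabilityMeasure (G.branchLaw ν i) := by
  have := isProbabilityMeasure_recommendationLaw (ν := ν) (disc (gridSize i)) (G.alg i) hn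
  unfold GPO.branchLaw
  infer_instance

/-- Exponential moments of the error of cross-validation in the branch `j`. -/
theorem GPO.integral_exp_error_le (hν : IsEnvironment ν f) (hn : 0 < phaseLength T)
    (j : Fin (numBranches T)) (l : ℝ) :
    Integrable (fun b : Fin (numBranches T) → I × ℝ => Real.exp (l * ((b j).2 - f (b j).1)))
      (Measure.pi (G.branchLaw ν)) ∧
    ∫ b, Real.exp (l * ((b j).2 - f (b j).1)) ∂(Measure.pi (G.branchLaw ν)) ≤
      Real.exp (l ^ 2 / (8 * phaseLength T)) := by
  have := hν.markov
  have hfm := hν.measurable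
  have hb := G.isProbabilityMeasure_branchLaw (ν := ν) hn
  have hrec := isProbabilityMeasure_recommendationLaw (ν := ν) (disc (gridSize j)) (G.alg j) hn
  have hm : Measurable fun q : I × ℝ => ENNReal.ofReal (Real.exp (l * (q.2 - f q.1))) := by
    fun_prop
  have hmR : Measurable fun b : Fin (numBranches T) → I × ℝ =>
      Real.exp (l * ((b j).2 - f (b j).1)) := by
    fun_prop
  have hle : ∫⁻ b, ENNReal.ofReal (Real.exp (l * ((b j).2 - f (b j).1)))
      ∂(Measure.pi (G.branchLaw ν)) ≤ ENNReal.ofReal (Real.exp (l ^ 2 / (8 * phaseLength T))) := by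
    have h1 := (measurePreserving_eval (G.branchLaw ν) j).lintegral_comp hm
    simp only [Function.eval] at h1
    rw [h1, GPO.branchLaw, Measure.lintegral_compProd hm]
    refine (lintegral_mono fun x => hν.lintegral_averageReward_le x l hn).trans ?_
    simp
  refine ⟨⟨hmR.aestronglyMeasurable, ?_⟩, ?_⟩
  · rw [hasFiniteIntegral_iff_ofReal (Filter.Eventually.of_forall fun _ => (Real.exp_pos _).le)]
    exact hle.trans_lt ENNReal.ofReal_lt_top
  · rw [integral_eq_lintegral_of_nonneg_ae
      (Filter.Eventually.of_forall fun _ => (Real.exp_pos _).le) hmR.aestronglyMeasurable]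
    exact ENNReal.toReal_le_of_le_ofReal (Real.exp_pos _).le hle

/-- The price of selecting a branch by cross-validation. -/
theorem GPO.simpleRegret_le_branch (hν : IsEnvironment ν f) (hf : ∀ x, f x ∈ Icc (0 : ℝ) 1)
    (hn : 0 < phaseLength T) (i₀ : Fin (numBranches T)) :
    G.simpleRegret ν f ≤
      maxValue f - ∫ x, f x ∂(recommendationLaw (disc (gridSize i₀)) (G.alg i₀) ν (phaseLength T))
        + (Real.log (numBranches T) / 4 + 1) * √(1 / phaseLength T) := by
  have := hν.markov
  have := G.markov
  have hfm := hν.measurable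
  have hb := G.isProbabilityMeasure_branchLaw (ν := ν) hn
  have hrec := isProbabilityMeasure_recommendationLaw (ν := ν) (disc (gridSize i₀)) (G.alg i₀) hn
  set n := phaseLength T with hndef
  have hnr : (0 : ℝ) < n := by exact_mod_cast hn
  have hp : 0 < numBranches T := i₀.pos
  have hpr : (0 : ℝ) < numBranches T := by exact_mod_cast hp
  set B := Measure.pi (G.branchLaw ν) with hB
  set p : ℝ := (numBranches T : ℝ) with hpdef
  -- This makes the exponential moments of ±l times a validation error at most e².
  set l : ℝ := 4 * √n with hl
  have hl0 : 0 < l := by positivity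
  have hl2 : l ^ 2 / (8 * n) = 2 := by
    rw [hl, mul_pow, Real.sq_sqrt hnr.le]; field_simp; norm_num
  let W : (Fin (numBranches T) → I × ℝ) → Fin (numBranches T) → ℝ := fun b j =>
    (b j).2 - f (b j).1
  -- An integrable majorant of max_j W_j - W_{i₀}, from u + 1 ≤ e^u with shifts 2 and 2 + log p.
  -- Both exponential terms have mean at most 1, so H has mean at most (log p + 4)/l. Only the
  -- marginal laws of the branches enter.
  let H : (Fin (numBranches T) → I × ℝ) → ℝ := fun b =>
    (Real.exp (-l * W b i₀) * Real.exp (-2) +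
      ∑ j, Real.exp (l * W b j) * (Real.exp (-2) / p) + (Real.log p + 2)) / l
  have hE : ∀ j l', Integrable (fun b => Real.exp (l' * W b j)) B := fun j l' =>
    (G.integral_exp_error_le hν hn j l').1
  have hEle : ∀ j, ∫ b, Real.exp (l * W b j) ∂B ≤ Real.exp 2 := fun j => by
    rw [← hl2]; exact (G.integral_exp_error_le hν hn j l).2
  have hEle' : ∫ b, Real.exp (-l * W b i₀) ∂B ≤ Real.exp 2 := by
    rw [← hl2, ← neg_sq]; exact (G.integral_exp_error_le hν hn i₀ (-l)).2
  have hI1 : Integrable (fun b => Real.exp (-l * W b i₀) * Real.exp (-2)) B :=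
    (hE i₀ (-l)).mul_const _
  have hI2 : Integrable (fun b => ∑ j, Real.exp (l * W b j) * (Real.exp (-2) / p)) B :=
    integrable_finsetSum _ fun j _ => (hE j l).mul_const _
  have hI12 : Integrable (fun b => Real.exp (-l * W b i₀) * Real.exp (-2) +
      ∑ j, Real.exp (l * W b j) * (Real.exp (-2) / p)) B := hI1.add hI2
  have hHint : Integrable H B := (hI12.add (integrable_const _)).div_const _
  have hHle : ∫ b, H b ∂B ≤ (Real.log p / 4 + 1) * √(1 / n) := by
    have hone : Real.exp 2 * Real.exp (-2) = 1 := by rw [← Real.exp_add]; simp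
    have h1 : ∫ b, Real.exp (-l * W b i₀) * Real.exp (-2) ∂B ≤ 1 := by
      rw [integral_mul_const, ← hone]
      gcongr
    have h2 : ∫ b, ∑ j, Real.exp (l * W b j) * (Real.exp (-2) / p) ∂B ≤ 1 := by
      rw [integral_finsetSum _ fun j _ => (hE j l).mul_const _]
      calc _ ≤ ∑ j : Fin (numBranches T), 1 / p := by
            refine Finset.sum_le_sum fun j _ => ?_
            rw [integral_mul_const, ← hone, mul_div_assoc]
            gcongr
            exact hEle j
        _ = 1 := by
            rw [Finset.sum_const, Finset.card_univ, Fintype.card_fin, nsmul_eq_mul]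
            exact mul_one_div_cancel hpr.ne'
    have h3 : ∫ b, H b ∂B = (∫ b, Real.exp (-l * W b i₀) * Real.exp (-2) ∂B +
        ∫ b, ∑ j, Real.exp (l * W b j) * (Real.exp (-2) / p) ∂B + (Real.log p + 2)) / l := by
      simp only [H]
      rw [integral_div, integral_add hI12 (integrable_const _), integral_add hI1 hI2]
      simp
    have h4 : (Real.log p / 4 + 1) * √(1 / n) = (1 + 1 + (Real.log p + 2)) / l := by
      rw [hl, Real.sqrt_div zero_le_one, Real.sqrt_one]
      field_simp
      ring
    rw [h3, h4]
    gcongr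
  have hpt : ∀ b i, (∀ j, (b j).2 ≤ (b i).2) → f (b i₀).1 - H b ≤ f (b i).1 := by
    intro b i hi
    have t1 : -l * W b i₀ - 2 + 1 ≤ Real.exp (-l * W b i₀) * Real.exp (-2) := by
      rw [← Real.exp_add]
      exact Real.add_one_le_exp _
    have t2 : l * W b i - 2 - Real.log p + 1 ≤ Real.exp (l * W b i) * (Real.exp (-2) / p) := by
      have : Real.exp (l * W b i) * (Real.exp (-2) / p) =
          Real.exp (l * W b i - 2 - Real.log p) := by
        rw [Real.exp_sub, Real.exp_sub, Real.exp_log hpr, Real.exp_neg]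
        field_simp
      rw [this]
      exact Real.add_one_le_exp _
    have t3 : Real.exp (l * W b i) * (Real.exp (-2) / p) ≤
        ∑ j, Real.exp (l * W b j) * (Real.exp (-2) / p) :=
      Finset.single_le_sum (f := fun j => Real.exp (l * W b j) * (Real.exp (-2) / p))
        (fun j _ => by positivity) (Finset.mem_univ i)
    have t4 : W b i - W b i₀ ≤ H b := by
      simp only [H]
      rw [le_div_iff₀ hl0]
      linarith
    have t5 := hi i₀
    simp only [W] at t4
    linarith
  set P := B ⊗ₘ G.select with hP
  have hfst : P.map Prod.fst = B := by
    rw [hP]; exact Measure.fst_compProd B G.select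
  have hae : ∀ᵐ q ∂P, ∀ j, (q.1 j).2 ≤ (q.1 q.2).2 := by
    have hms : MeasurableSet {q : (Fin (numBranches T) → I × ℝ) × Fin (numBranches T) |
        ∀ j, (q.1 j).2 ≤ (q.1 q.2).2} := by
      have hq : Measurable fun q : (Fin (numBranches T) → I × ℝ) × Fin (numBranches T) =>
          (q.1 q.2).2 := measurable_from_prod_countable_left fun s => by
        change Measurable fun b : Fin (numBranches T) → I × ℝ => (b s).2
        fun_prop
      rw [ofPred_forall]
      exact MeasurableSet.iInter fun j => measurableSet_le (by fun_prop) hq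
    rw [hP, Measure.ae_compProd_iff hms]
    exact Filter.Eventually.of_forall G.select_max
  have hout : Measurable fun q : (Fin (numBranches T) → I × ℝ) × Fin (numBranches T) =>
      (q.1 q.2).1 := measurable_from_prod_countable_left fun s => by
    change Measurable fun b : Fin (numBranches T) → I × ℝ => (b s).1
    fun_prop
  have hbdd : ∀ {Ω : Type} [MeasurableSpace Ω] (Q : Measure Ω) [IsProbabilityMeasure Q] (g : Ω → I),
      Measurable g → Integrable (fun ω => f (g ω)) Q := fun Q _ g hg =>
    Integrable.of_mem_Icc 0 1 (hfm.comp hg).aemeasurable (Filter.Eventually.of_forall fun _ => hf _)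
  have hI0 : Integrable (fun b : Fin (numBranches T) → I × ℝ => f (b i₀).1) B :=
    hbdd B _ (by fun_prop)
  have hlow : Integrable (fun b => f (b i₀).1 - H b) B := hI0.sub hHint
  have hmain : ∫ b, (f (b i₀).1 - H b) ∂B ≤ ∫ q, f (q.1 q.2).1 ∂P := by
    rw [← hfst, integral_map measurable_fst.aemeasurable (by rw [hfst]; exact hlow.1)]
    refine integral_mono_ae ?_ (hbdd P _ hout) ?_
    · have := hlow
      rw [← hfst] at this
      exact this.comp_measurable measurable_fst
    · filter_upwards [hae] with q hq
      exact hpt q.1 q.2 hq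
  have hrecint : ∫ b, f (b i₀).1 ∂B =
      ∫ x, f x ∂(recommendationLaw (disc (gridSize i₀)) (G.alg i₀) ν n) := by
    have h1 : (G.branchLaw ν i₀).map Prod.fst =
        recommendationLaw (disc (gridSize i₀)) (G.alg i₀) ν n := by
      rw [GPO.branchLaw]; exact Measure.fst_compProd _ _
    have h2 : B.map (Function.eval i₀) = G.branchLaw ν i₀ :=
      (measurePreserving_eval (G.branchLaw ν) i₀).map_eq
    rw [← h1, integral_map measurable_fst.aemeasurable hfm.aestronglyMeasurable, ← h2,
      integral_map (measurable_pi_apply i₀).aemeasurable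
        (hfm.comp measurable_fst).aestronglyMeasurable]
  have houtint : ∫ x, f x ∂(G.outputLaw ν) = ∫ q, f (q.1 q.2).1 ∂P := by
    rw [GPO.outputLaw, integral_map hout.aemeasurable hfm.aestronglyMeasurable]
  rw [GPO.simpleRegret, houtint]
  rw [integral_sub hI0 hHint, hrecint] at hmain
  linarith

end CrossValidation

/-! ### Phase lengths, balancing of the grid size and final constants. -/

theorem two_mul_numBranches_le {T : ℕ} (hT : 8 ≤ T) : 2 * numBranches T ≤ T := by
  have hT0 : (0 : ℝ) < T := by exact_mod_cast (by omega : 0 < T)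
  obtain ⟨k, hk⟩ : ∃ k, numBranches T = k + 1 := Nat.exists_eq_succ_of_ne_zero (p_pos hT).ne'
  have h1 : (k : ℝ) < Real.logb 2 T := by
    have : k < ⌈Real.logb 2 T⌉₊ := by
      change k < numBranches T
      omega
    exact Nat.lt_ceil.1 this
  have h2 : 2 ^ k < T := by
    rw [Real.lt_logb_iff_rpow_lt (by norm_num) hT0, Real.rpow_natCast] at h1
    exact_mod_cast h1
  have h3 : ∀ k, 3 ≤ k → 2 * (k + 1) ≤ 2 ^ k := by
    intro k hk
    induction k, hk using Nat.le_induction with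
    | base => norm_num
    | succ k hk ih => rw [pow_succ]; omega
  rw [hk]
  rcases le_or_gt 3 k with h | h
  · have := h3 k h
    omega
  · omega

theorem phaseLength_pos {T : ℕ} (hT : 8 ≤ T) : 0 < phaseLength T :=
  Nat.div_pos (two_mul_numBranches_le hT) (Nat.mul_pos two_pos (p_pos hT))

/-- As n ≥ 1, rounding down loses at most a factor 2: T < 2p(n + 1) ≤ 4pn. -/
theorem one_div_phaseLength_le {T : ℕ} (hT : 8 ≤ T) :
    1 / (phaseLength T : ℝ) ≤ 4 * ((numBranches T : ℝ) / T) := by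
  have hn := phaseLength_pos hT
  have hnr : (0 : ℝ) < phaseLength T := by exact_mod_cast hn
  have hT0 : (0 : ℝ) < T := by exact_mod_cast (by omega : 0 < T)
  have h1 : T < 2 * numBranches T * (phaseLength T + 1) :=
    Nat.lt_mul_div_succ T (Nat.mul_pos two_pos (p_pos hT))
  have h2 : 2 * numBranches T * (phaseLength T + 1) ≤ 4 * numBranches T * phaseLength T := by
    nlinarith
  have h3 : (T : ℝ) ≤ 4 * numBranches T * phaseLength T := by exact_mod_cast (h1.le.trans h2)
  rw [← mul_div_assoc, div_le_div_iff₀ hnr hT0]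
  linarith

theorem numBranches_le {T : ℕ} (hT : 8 ≤ T) : (numBranches T : ℝ) ≤ Real.logb 2 T + 1 :=
  (Nat.ceil_lt_add_one (Real.logb_nonneg (by norm_num)
    (by exact_mod_cast (by omega : 1 ≤ T)))).le

theorem le_two_pow_numBranches {T : ℕ} (hT : 8 ≤ T) : (T : ℝ) ≤ 2 ^ numBranches T := by
  have hT0 : (0 : ℝ) < T := by exact_mod_cast (by omega : 0 < T)
  have h : Real.logb 2 T ≤ (numBranches T : ℝ) := Nat.le_ceil _
  rwa [Real.logb_le_iff_le_rpow (by norm_num) hT0, Real.rpow_natCast] at h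

/-- The number of pieces that balances the approximation error and the cost of exploration. -/
def balancedSize (L ρ α : ℝ) : ℝ := (L ^ 2 / ρ) ^ (1 / (2 * α + 1))

section Balance

variable {L ρ α : ℝ}

/-- With `balancedSize_mul`, this shows that the approximation error and √(κρ) coincide at κ. -/
theorem balancedSize_approximation (hL : 0 < L) (hρ : 0 < ρ) (hα : 0 < α) :
    L * (balancedSize L ρ α ^ α)⁻¹ = L ^ (1 / (2 * α + 1)) * ρ ^ (α / (2 * α + 1)) := by
  have h : (2 * α + 1) ≠ 0 := by positivity
  have h1 : Real.log (L ^ 2 / ρ) = 2 * Real.log L - Real.log ρ := by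
    rw [Real.log_div (by positivity) hρ.ne', Real.log_pow]; norm_num
  unfold balancedSize
  rw [← Real.rpow_mul (by positivity), Real.rpow_def_of_pos (by positivity : 0 < L ^ 2 / ρ),
    Real.rpow_def_of_pos hL, Real.rpow_def_of_pos hρ, ← Real.exp_neg, ← Real.exp_add, h1]
  nth_rewrite 1 [← Real.exp_log hL]
  rw [← Real.exp_add]
  congr 1
  field_simp
  ring

theorem balancedSize_mul (hL : 0 < L) (hρ : 0 < ρ) (hα : 0 < α) :
    balancedSize L ρ α * ρ = (L ^ (1 / (2 * α + 1)) * ρ ^ (α / (2 * α + 1))) ^ 2 := by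
  have h : (2 * α + 1) ≠ 0 := by positivity
  have h1 : Real.log (L ^ 2 / ρ) = 2 * Real.log L - Real.log ρ := by
    rw [Real.log_div (by positivity) hρ.ne', Real.log_pow]; norm_num
  unfold balancedSize
  rw [Real.rpow_def_of_pos (by positivity : 0 < L ^ 2 / ρ), Real.rpow_def_of_pos hL,
    Real.rpow_def_of_pos hρ, ← Real.exp_add, ← Real.exp_nat_mul, h1]
  nth_rewrite 2 [← Real.exp_log hρ]
  rw [← Real.exp_add]
  congr 1
  push_cast
  field_simp
  ring

theorem two_le_balancedSize (hρ : 0 < ρ) (hα : 0 < α) (hL : 2 ^ (α + 1 / 2) * √ρ ≤ L) :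
    2 ≤ balancedSize L ρ α := by
  have h1 : (2 : ℝ) ^ (2 * α + 1) * ρ ≤ L ^ 2 := by
    have h2 : (2 ^ (α + 1 / 2) * √ρ) ^ 2 = (2 : ℝ) ^ (2 * α + 1) * ρ := by
      rw [mul_pow, Real.sq_sqrt hρ.le, ← Real.rpow_mul_natCast (by norm_num)]
      congr 2
      push_cast
      ring
    rw [← h2]
    gcongr
  have h3 : (2 : ℝ) = ((2 : ℝ) ^ (2 * α + 1)) ^ (1 / (2 * α + 1)) := by
    rw [← Real.rpow_mul (by norm_num), mul_one_div_cancel (by positivity), Real.rpow_one]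
  refine h3.trans_le (Real.rpow_le_rpow (by positivity) ?_ (by positivity))
  rw [le_div_iff₀ hρ]
  exact h1

end Balance

theorem exists_gridSize {p : ℕ} {κ : ℝ} (h1 : 2 ≤ κ) (h2 : κ ≤ 2 ^ p) :
    ∃ i : Fin p, κ ≤ gridSize i ∧ (gridSize i : ℝ) ≤ 2 * κ := by
  classical
  have hex : ∃ k : ℕ, κ ≤ 2 ^ k := ⟨p, h2⟩
  have hk := Nat.find_spec hex
  -- The least exponent is positive because κ ≥ 2, as needed for branches whose sizes start at 2.
  have hkp : Nat.find hex ≤ p := Nat.find_min' hex h2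
  obtain ⟨j, hj⟩ : ∃ j, Nat.find hex = j + 1 := by
    refine Nat.exists_eq_succ_of_ne_zero fun h0 => ?_
    rw [h0] at hk
    norm_num at hk
    linarith
  have hj' : ¬ κ ≤ 2 ^ j := Nat.find_min hex (by omega)
  rw [hj] at hk
  refine ⟨⟨j, by omega⟩, ?_, ?_⟩
  · simp only [gridSize]; push_cast; exact hk
  · simp only [gridSize]; push_cast; rw [pow_succ]; linarith

theorem GPO.simpleRegret_le_one {T : ℕ} (G : GPO T) {ν : Kernel I ℝ} {f : I → ℝ} {L α : ℝ}
    (hf : f ∈ holderClass L α) : G.simpleRegret ν f ≤ 1 := by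
  obtain ⟨hf01, xs, hxs, -⟩ := hf
  have h1 : 0 ≤ ∫ x, f x ∂(G.outputLaw ν) := integral_nonneg fun x => (hf01 x).1
  have h2 := (hf01 xs).2
  rw [GPO.simpleRegret, ← hxs]
  linarith

theorem GPO.simpleRegret_le {T : ℕ} (hT : 8 ≤ T) (G : GPO T) {α L : ℝ} (hα : 0 < α)
    (hL : (2 : ℝ) ^ (α + 1 / 2) * √((numBranches T : ℝ) / T) ≤ L) {f : I → ℝ}
    (hf : f ∈ holderClass L α) {ν : Kernel I ℝ} (hν : IsEnvironment ν f) :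
    G.simpleRegret ν f ≤ (54 + √Real.pi / 2 * Real.logb 2 T) * L ^ (1 / (2 * α + 1))
      * ((numBranches T : ℝ) / T) ^ (α / (2 * α + 1)) := by
  have hT0 : (0 : ℝ) < T := by exact_mod_cast (by omega : 0 < T)
  have hp := p_pos hT
  have hp1 : (1 : ℝ) ≤ numBranches T := by exact_mod_cast hp
  have hp0 : (0 : ℝ) < numBranches T := by linarith
  set ρ : ℝ := (numBranches T : ℝ) / T with hρdef
  have hρ : 0 < ρ := by positivity
  have hLpos : 0 < L := lt_of_lt_of_le (by positivity) hL
  have hlog : 0 ≤ Real.logb 2 T :=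
    Real.logb_nonneg (by norm_num) (by exact_mod_cast (by omega : 1 ≤ T))
  have hκ2 := two_le_balancedSize hρ hα hL
  have hκU := balancedSize_mul hLpos hρ hα
  have hκL := balancedSize_approximation hLpos hρ hα
  rw [mul_assoc]
  set U := L ^ (1 / (2 * α + 1)) * ρ ^ (α / (2 * α + 1)) with hU
  set κ := balancedSize L ρ α with hκ
  have hU0 : 0 < U := by positivity
  have hκ0 : 0 < κ := by linarith
  have hπ : 1 ≤ √Real.pi := Real.one_le_sqrt.2 (by linarith [Real.pi_gt_three])
  have hcoef : 0 ≤ √Real.pi / 2 * Real.logb 2 T := by positivity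
  -- In the first case the constants are 1 + 17·3 + 3/2 ≤ 54 and 3/8 ≤ √π/2: the grid costs √8 U ≤
  -- 3U, and κ ≥ 2 gives √(1/n) ≤ √2 U ≤ 3U/2.
  rcases le_or_gt κ (2 ^ numBranches T) with hle | hgt
  · obtain ⟨i, hi1, hi2⟩ := exists_gridSize hκ2 hle
    have hn := phaseLength_pos hT
    have hnr : (0 : ℝ) < phaseLength T := by exact_mod_cast hn
    have hninv := one_div_phaseLength_le hT
    have h1 := G.simpleRegret_le_branch hν hf.1 hn i
    have h2 := hν.maxValue_sub_integral_recommendationLaw_le hα.le hLpos.le hf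
      (K := gridSize i) (by unfold gridSize; positivity) hn (G.isMOSS i)
    have h3 : L * (((gridSize i : ℕ) : ℝ) ^ α)⁻¹ ≤ U := by
      rw [← hκL]
      have := Real.rpow_le_rpow hκ0.le hi1 hα.le
      gcongr
    have h4 : √(((gridSize i : ℕ) : ℝ) / phaseLength T) ≤ 3 * U := by
      refine Real.sqrt_le_iff.2 ⟨by positivity, ?_⟩
      calc ((gridSize i : ℕ) : ℝ) / phaseLength T = gridSize i * (1 / phaseLength T) := by
            rw [mul_one_div]
        _ ≤ (2 * κ) * (4 * ρ) := by gcongr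
        _ = 8 * U ^ 2 := by rw [← hκU]; ring
        _ ≤ (3 * U) ^ 2 := by nlinarith [sq_nonneg U]
    have h5 : √(1 / (phaseLength T : ℝ)) ≤ 3 / 2 * U := by
      refine Real.sqrt_le_iff.2 ⟨by positivity, ?_⟩
      calc 1 / (phaseLength T : ℝ) ≤ 2 * (2 * ρ) := by linarith
        _ ≤ 2 * (κ * ρ) := by gcongr
        _ = 2 * U ^ 2 := by rw [hκU]
        _ ≤ (3 / 2 * U) ^ 2 := by nlinarith [sq_nonneg U]
    have h6 : Real.log (numBranches T) ≤ Real.logb 2 T := by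
      have := Real.log_le_sub_one_of_pos hp0
      have := numBranches_le hT
      linarith
    have h7 : (Real.log (numBranches T) / 4 + 1) * √(1 / (phaseLength T : ℝ)) ≤
        (Real.logb 2 T / 4 + 1) * (3 / 2 * U) := by
      gcongr
    have h8 : Real.logb 2 T * U ≤ √Real.pi * (Real.logb 2 T * U) :=
      le_mul_of_one_le_left (by positivity) hπ
    have h9 : 0 ≤ Real.logb 2 T * U := by positivity
    nlinarith
  · refine (G.simpleRegret_le_one hf).trans ?_
    have h1 : 1 ≤ U ^ 2 := by
      rw [← hκU]
      have h2 : (T : ℝ) ≤ κ := (le_two_pow_numBranches hT).trans hgt.le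
      calc (1 : ℝ) ≤ numBranches T := hp1
        _ = T * ρ := by rw [hρdef]; field_simp
        _ ≤ κ * ρ := by gcongr
    have h2 : 1 ≤ U := by
      by_contra h
      have : U < 1 := not_le.1 h
      nlinarith
    nlinarith

/-- The regret bound of GPO is of order `L ^ (1 / (2α + 1)) T ^ (-α / (2α + 1))` up to a power of
`log T`. -/
theorem bound_le_log_mul {T : ℕ} (hT : 8 ≤ T) {α L : ℝ} (hα : 0 < α) (hL : 0 < L) :
    (54 + √Real.pi / 2 * Real.logb 2 T) * L ^ (1 / (2 * α + 1))
        * ((numBranches T : ℝ) / T) ^ (α / (2 * α + 1)) ≤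
      224 * Real.log T ^ (2 : ℝ) * (L ^ (1 / (2 * α + 1)) * (T : ℝ) ^ (-(α / (2 * α + 1)))) := by
  have hT8 : (8 : ℝ) ≤ T := by exact_mod_cast hT
  have hT0 : (0 : ℝ) < T := by linarith
  have hp1 : (1 : ℝ) ≤ numBranches T := by exact_mod_cast p_pos hT
  have hlog2 : (1 : ℝ) / 2 < Real.log 2 := by linarith [Real.log_two_gt_d9]
  have hlogT : 1 ≤ Real.log T := by
    have h1 : Real.log 8 ≤ Real.log T := Real.log_le_log (by norm_num) hT8
    have h2 : Real.log 8 = 3 * Real.log 2 := by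
      rw [show (8 : ℝ) = 2 ^ 3 by norm_num, Real.log_pow]; norm_num
    linarith
  have hlb : Real.logb 2 T ≤ 2 * Real.log T := by
    rw [Real.logb, div_le_iff₀ (by linarith)]
    nlinarith
  have hlb0 : 0 ≤ Real.logb 2 T := Real.logb_nonneg (by norm_num) (by linarith)
  have hp : (numBranches T : ℝ) ≤ 4 * Real.log T := by
    have := numBranches_le hT
    linarith
  have hexp : α / (2 * α + 1) ≤ 1 := by
    rw [div_le_one (by positivity)]; linarith
  -- An exponent at most 1 on a base p ≥ 1 makes the logarithmic factor uniform in α.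
  have hpe : (numBranches T : ℝ) ^ (α / (2 * α + 1)) ≤ 4 * Real.log T :=
    (Real.rpow_le_rpow_of_exponent_le hp1 hexp).trans (by rwa [Real.rpow_one])
  have hπ : √Real.pi ≤ 2 := by
    rw [Real.sqrt_le_left (by norm_num)]
    linarith [Real.pi_le_four]
  have hcoef : 54 + √Real.pi / 2 * Real.logb 2 T ≤ 56 * Real.log T := by
    have : √Real.pi / 2 * Real.logb 2 T ≤ 1 * (2 * Real.log T) := by
      gcongr
      linarith
    linarith
  rw [Real.div_rpow (by positivity) hT0.le, Real.rpow_two, Real.rpow_neg hT0.le, div_eq_mul_inv]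
  calc _ = (54 + √Real.pi / 2 * Real.logb 2 T) * (numBranches T : ℝ) ^ (α / (2 * α + 1)) *
        (L ^ (1 / (2 * α + 1)) * ((T : ℝ) ^ (α / (2 * α + 1)))⁻¹) := by ring
    _ ≤ (56 * Real.log T) * (4 * Real.log T) *
        (L ^ (1 / (2 * α + 1)) * ((T : ℝ) ^ (α / (2 * α + 1)))⁻¹) := by gcongr
    _ = _ := by ring

end XBandit

end

theorem theorem3 :
    (∀ (T : ℕ), 8 ≤ T → ∀ G : XBandit.GPO T,
      ∀ α L : ℝ, 0 < α →
        (2 : ℝ) ^ (α + 1 / 2) * √((⌈Real.logb 2 T⌉₊ : ℝ) / T) ≤ L →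
        ∀ f ∈ XBandit.holderClass L α, ∀ ν : ProbabilityTheory.Kernel unitInterval ℝ,
          XBandit.IsEnvironment ν f →
          G.simpleRegret ν f ≤
            (54 + √Real.pi / 2 * Real.logb 2 T) * L ^ (1 / (2 * α + 1))
              * ((⌈Real.logb 2 T⌉₊ : ℝ) / T) ^ (α / (2 * α + 1))) ∧
    (∃ C k : ℝ, ∀ (T : ℕ), 8 ≤ T → ∀ α L : ℝ, 0 < α → 0 < L →
      (54 + √Real.pi / 2 * Real.logb 2 T) * L ^ (1 / (2 * α + 1))
          * ((⌈Real.logb 2 T⌉₊ : ℝ) / T) ^ (α / (2 * α + 1)) ≤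
        C * (Real.log T) ^ k * (L ^ (1 / (2 * α + 1)) * (T : ℝ) ^ (-(α / (2 * α + 1))))) :=
  ⟨fun _ hT G _ _ hα hL _ hf _ hν => G.simpleRegret_le hT hα hL hf hν,
    224, 2, fun _ hT _ _ hα hL => XBandit.bound_le_log_mul hT hα hL⟩
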